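/- Let $\Bbbk$ be an algebraically closed field and let $\mathcal E$ be a $\Bbbk$-linear additive category such that: (a) $\mathcal E$ is Krull–Schmidt, i.e. every object is a finite direct sum of objects with local endomorphism rings; (b) $\dim_\Bbbk \mathcal E(X,Y)<\infty$ for all $X,Y$; (c) the category $\operatorname{mod}\mathcal E$ of finitely presented contravariant functors $\mathcal E\to\mathrm{Ab}$ (cokernels of maps $\mathcal E(-,X)\to\mathcal E(-,Y)$) is abelian (equivalently, $\mathcal E$ has weak kernels); (d) $\operatorname{mod}\mathcal E$ has finite global dimension. Let $\mathcal E$ carry a Frobenius exact structure (a Quillen exact structure with enough projective and enough injective objects, in which projective and injective objects coincide), and let $\mathcal P$ be its class of projective-injective objects. Let $\mathcal E/\mathcal P$ be the additive quotient of $\mathcal E$ by the ideal of morphisms factoring through objects of $\mathcal P$, with suspension $\Sigma$ the cosyzygy functor. Suppose this stable category is $2$-Calabi–Yau, i.e. there are $\Bbbk$-linear isomorphisms $\operatorname{Hom}_{\mathcal E/\mathcal P}(X,Y)\cong \operatorname{Hom}_\Bbbk(\operatorname{Hom}_{\mathcal E/\mathcal P}(Y,\Sigma^2X),\Bbbk)$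 natural in $X$ and $Y$. Let $\mathcal T\subseteq\mathcal E$ be a cluster-tilting subcategory, i.e. a full subcategory such that $\operatorname{Ext}^1(T,T')=0$ for all $T,T'\in\mathcal T$; every object $X$ with $\operatorname{Ext}^1(T,X)=0$ for all $T\in\mathcal T$ lies in $\mathcal T$; and $\mathcal T$ is functorially finite in $\mathcal E$ (every object of $\mathcal E$ has a right and a left $\mathcal T$-approximation). Here $\operatorname{Ext}^1$ is taken in the exact category $\mathcal E$. The quiver of a category $\mathcal A$ has as vertices the isomorphism classes $[X]$ of indecomposable objects, and an arrow $[X]\to[Y]$ precisely if $\operatorname{rad}_{\mathcal A}(X,Y)/\operatorname{rad}^2_{\mathcal A}(X,Y)\neq 0$, where $\operatorname{rad}_{\mathcal A}(X,Y)$ consists of the morphisms $f\colon X\to Y$ such that $1_X-gf$ is invertible for all $g\colon Y\to X$, and $\operatorname{rad}^2_{\mathcal A}(X,Y)$ of the composites of two radical morphisms. Then the quiver of $\mathcal T/\mathcal P$, the quotient of $\mathcal T$ by the morphisms factoring through objects of $\mathcal P$, has no loops and no $2$-cycles: there is no vertex $x$ with an arrow $x\to x$, and there are no vertices $x,y$ with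 arrows $x\to y$ and $y\to x$. -/

import Mathlib

open CategoryTheory CategoryTheory.Limits

universe w v u

namespace FrobeniusCT

/-! ### Krull--Schmidt categories, the radical and the quiver of a category -/

/-- Every object is a finite direct sum of objects with local endomorphism rings
(the empty direct sum being allowed). -/
def IsKrullSchmidt (C : Type u) [Category.{v} C] [Preadditive C] [HasFiniteBiproducts C] : Prop :=
  ∀ X : C, ∃ (n : ℕ) (Y : Fin n → C),
    (∀ i, IsLocalRing (End (Y i))) ∧ Nonempty (X ≅ ⨁ Y)

section Quiver

variable {C : Type u} [Category.{v} C] [Preadditive C]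

/-- `X` is nonzero and in every decomposition `X ≅ Y ⊕ Z` one of `Y`, `Z` is zero. (Phrased with
biproduct bicones, so that the existence of all biproducts need not be known beforehand.) -/
def IsIndecomposable (X : C) : Prop :=
  ¬ IsZero X ∧ ∀ (Y Z : C) (b : BinaryBicone Y Z),
    Nonempty b.IsBilimit → Nonempty (X ≅ b.pt) → IsZero Y ∨ IsZero Z

/-- `f : X ⟶ Y` lies in the radical: `1 - g ∘ f` is invertible for every `g : Y ⟶ X`. -/
def InRad {X Y : C} (f : X ⟶ Y) : Prop :=
  ∀ g : Y ⟶ X, IsIso (𝟙 X - f ≫ g)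

/-- `f` lies in the square of the radical: it is a composite of two radical morphisms. -/
def InRadSq {X Y : C} (f : X ⟶ Y) : Prop :=
  ∃ (Z : C) (g : X ⟶ Z) (h : Z ⟶ Y), InRad g ∧ InRad h ∧ f = g ≫ h

/-- `rad(X, Y) / rad²(X, Y) ≠ 0`. -/
def HasIrreducible (X Y : C) : Prop :=
  ∃ f : X ⟶ Y, InRad f ∧ ¬ InRadSq f

variable (C)

/-- Vertices of the quiver of `C`: isomorphism classes of indecomposable objects. -/
def QuiverVertex : Type u :=
  {x : _root_.Quotient (isIsomorphicSetoid C) //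
    ∃ X : C, IsIndecomposable X ∧ _root_.Quotient.mk (isIsomorphicSetoid C) X = x}

/-- The quiver of `C`, without double arrows: there is an arrow `[X] ⟶ [Y]` precisely if
`rad(X, Y) / rad²(X, Y) ≠ 0`. -/
instance quiverOfCategory : Quiver.{0} (QuiverVertex C) where
  Hom x y := PLift (∃ X Y : C, _root_.Quotient.mk (isIsomorphicSetoid C) X = x.1 ∧
    _root_.Quotient.mk (isIsomorphicSetoid C) Y = y.1 ∧ HasIrreducible X Y)

end Quiver

/-- A quiver has no loops. -/
def NoLoops (Q : Type u) [Quiver.{0} Q] : Prop :=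
  ∀ x : Q, IsEmpty (x ⟶ x)

/-- A quiver has no 2-cycles. -/
def NoTwoCycles (Q : Type u) [Quiver.{0} Q] : Prop :=
  ∀ x y : Q, IsEmpty ((x ⟶ y) × (y ⟶ x))

/-! ### Finitely presented functors -/

/-- A contravariant functor to abelian groups is finitely presented if it is the cokernel of
`C(-, f) : C(-, X) ⟶ C(-, Y)` for some `f : X ⟶ Y`. -/
def isFinPres (C : Type u) [Category.{v} C] [Preadditive C] :
    ObjectProperty (Cᵒᵖ ⥤ AddCommGrpCat.{v}) :=
  fun F => ∃ (X Y : C) (f : X ⟶ Y), Nonempty (F ≅ cokernel (preadditiveYoneda.map f))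

/-- The category `mod C` of finitely presented contravariant functors. -/
abbrev ModCat (C : Type u) [Category.{v} C] [Preadditive C] :=
  (isFinPres C).FullSubcategory

/-- A preadditive category is abelian. -/
structure IsAbelian (A : Type u) [Category.{v} A] [Preadditive A] : Prop where
  finite_products : HasFiniteProducts A
  kernels : HasKernels A
  cokernels : HasCokernels A
  normal_mono : IsNormalMonoCategory A
  normal_epi : IsNormalEpiCategory A

/-- The resulting abelian category structure in the sense of Mathlib. -/
@[reducible]
def IsAbelian.toAbelian {A : Type u} [Category.{v} A] [Preadditive A] (h : IsAbelian A) :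
    Abelian A :=
  have := h.finite_products
  have := h.kernels
  have := h.cokernels
  have := h.normal_mono
  have := h.normal_epi
  { toPreadditive := inferInstance
    normalMonoOfMono := h.normal_mono.normalMonoOfMono
    normalEpiOfEpi := h.normal_epi.normalEpiOfEpi }

/-- Finite global dimension: a uniform bound on the projective dimensions of all objects, i.e. for
some `n`, all groups `Ext^i(F, G)` with `i > n` vanish. -/
def IsAbelian.FiniteGlobalDimension {A : Type u} [Category.{v} A] [Preadditive A]
    (h : IsAbelian A) : Prop :=
  letI := h.toAbelian
  ∃ n : ℕ, ∀ F : A, HasProjectiveDimensionLE F n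

/-! ### The additive quotient by a class of objects -/

section AddQuotient

variable {C : Type u} [Category.{v} C] [Preadditive C]

/-- The ideal of morphisms generated by those factoring through an object of `P`. (If `P` is closed
under finite direct sums, every element factors through a single object of `P`.) -/
def factorIdeal (P : ObjectProperty C) (X Y : C) : AddSubgroup (X ⟶ Y) :=
  AddSubgroup.closure {f | ∃ (Z : C) (_ : P Z) (a : X ⟶ Z) (b : Z ⟶ Y), f = a ≫ b}

theorem factorIdeal_comp_right (P : ObjectProperty C) {X Y Z : C} {f : X ⟶ Y}
    (hf : f ∈ factorIdeal P X Y) (g : Y ⟶ Z) : f ≫ g ∈ factorIdeal P X Z := by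
  have : factorIdeal P X Y ≤ (factorIdeal P X Z).comap (Preadditive.rightComp X g) := by
    refine (AddSubgroup.closure_le _).2 ?_
    rintro _ ⟨W, hW, a, b, rfl⟩
    exact AddSubgroup.subset_closure ⟨W, hW, a, b ≫ g, Category.assoc _ _ _⟩
  exact this hf

theorem factorIdeal_comp_left (P : ObjectProperty C) {X Y Z : C} (f : X ⟶ Y) {g : Y ⟶ Z}
    (hg : g ∈ factorIdeal P Y Z) : f ≫ g ∈ factorIdeal P X Z := by
  have : factorIdeal P Y Z ≤ (factorIdeal P X Z).comap (Preadditive.leftComp Z f) := by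
    refine (AddSubgroup.closure_le _).2 ?_
    rintro _ ⟨W, hW, a, b, rfl⟩
    exact AddSubgroup.subset_closure ⟨W, hW, f ≫ a, b, (Category.assoc _ _ _).symm⟩
  exact this hg

theorem factorIdeal_smul {k : Type w} [Field k] [Linear k C] (P : ObjectProperty C) {X Y : C}
    (c : k) {f : X ⟶ Y} (hf : f ∈ factorIdeal P X Y) : c • f ∈ factorIdeal P X Y := by
  have := factorIdeal_comp_right P hf (c • 𝟙 Y)
  simpa using this

/-- Two morphisms are identified if their difference lies in the ideal. -/
def idealRel (P : ObjectProperty C) : HomRel C :=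
  fun X Y f g => f - g ∈ factorIdeal P X Y

instance (P : ObjectProperty C) : Congruence (idealRel P) where
  equivalence :=
    { refl := fun f => by simp [idealRel]
      symm := fun {f g} h => by
        have := (factorIdeal P _ _).neg_mem h
        simpa [idealRel] using this
      trans := fun {f g h} h₁ h₂ => by
        have := (factorIdeal P _ _).add_mem h₁ h₂
        simpa [idealRel] using this }
  comp_left {_ _ _} f {g g'} h := by
    have := factorIdeal_comp_left P f (g := g - g') h
    simpa [idealRel] using this
  comp_right {_ _ _} {f f'} g h := by
    have := factorIdeal_comp_right P (f := f - f') h g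
    simpa [idealRel] using this

theorem idealRel_add (P : ObjectProperty C) ⦃X Y : C⦄ (f₁ f₂ g₁ g₂ : X ⟶ Y)
    (hf : idealRel P f₁ f₂) (hg : idealRel P g₁ g₂) : idealRel P (f₁ + g₁) (f₂ + g₂) := by
  have := (factorIdeal P _ _).add_mem hf hg
  simpa only [idealRel, add_sub_add_comm] using this

theorem idealRel_smul {k : Type w} [Field k] [Linear k C] (P : ObjectProperty C) (c : k)
    ⦃X Y : C⦄ (f g : X ⟶ Y) (h : idealRel P f g) : idealRel P (c • f) (c • g) := by
  have := factorIdeal_smul P c h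
  simpa only [idealRel, smul_sub] using this

/-- The additive quotient `C / P`: the objects of `C`, with morphisms taken modulo the ideal of
those factoring through `P`. -/
abbrev AddQuotient (P : ObjectProperty C) := CategoryTheory.Quotient (idealRel P)

instance addQuotientPreadditive (P : ObjectProperty C) : Preadditive (AddQuotient P) :=
  CategoryTheory.Quotient.preadditive (idealRel P) (idealRel_add P)

instance addQuotientFunctorAdditive (P : ObjectProperty C) :
    (CategoryTheory.Quotient.functor (idealRel P)).Additive :=
  CategoryTheory.Quotient.functor_additive (idealRel P) (idealRel_add P)

instance addQuotientLinear {k : Type w} [Field k] [Linear k C] (P : ObjectProperty C) :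
    Linear k (AddQuotient P) :=
  CategoryTheory.Quotient.linear k (idealRel P) (idealRel_smul P)

end AddQuotient

/-- `T` is functorially finite: every object has a right and a left `T`-approximation. -/
def FunctoriallyFinite {C : Type u} [Category.{v} C] (T : ObjectProperty C) : Prop :=
  (∀ X : C, ∃ (M : C) (f : M ⟶ X), T M ∧ ∀ (N : C), T N → ∀ g : N ⟶ X, ∃ h : N ⟶ M, h ≫ f = g) ∧
  (∀ X : C, ∃ (M : C) (f : X ⟶ M), T M ∧ ∀ (N : C), T N → ∀ g : X ⟶ N, ∃ h : M ⟶ N, f ≫ h = g)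

/-! ### Exact categories -/

/-- `i : A ⟶ B` is the first map of some member `A ⟶ B ⟶ Z` of the class `𝒮`. -/
def IsInflation {C : Type u} [Category.{v} C] [Preadditive C] (𝒮 : ObjectProperty (ShortComplex C))
    {A B : C} (i : A ⟶ B) : Prop :=
  ∃ (Z : C) (p : B ⟶ Z) (h : i ≫ p = 0), 𝒮 (ShortComplex.mk i p h)

/-- `p : A ⟶ B` is the second map of some member `Z ⟶ A ⟶ B` of the class `𝒮`. -/
def IsDeflation {C : Type u} [Category.{v} C] [Preadditive C] (𝒮 : ObjectProperty (ShortComplex C))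
    {A B : C} (p : A ⟶ B) : Prop :=
  ∃ (Z : C) (i : Z ⟶ A) (h : i ≫ p = 0), 𝒮 (ShortComplex.mk i p h)

/-- An exact structure in the sense of Quillen: a class of kernel-cokernel pairs
`A ⟶ B ⟶ C` (the conflations; the first maps are the inflations, the second maps the deflations),
closed under isomorphism, such that identities are inflations and deflations, inflations and
deflations are closed under composition, pushouts of inflations along arbitrary morphisms exist and
are inflations, and dually for pullbacks of deflations. -/
structure ExactStructure (C : Type u) [Category.{v} C] [Preadditive C] where
  conflation : ObjectProperty (ShortComplex C)
  of_iso : ∀ {S S' : ShortComplex C}, (S ≅ S') → conflation S → conflation S'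
  isKernel : ∀ S : ShortComplex C, conflation S → Nonempty (IsLimit (KernelFork.ofι S.f S.zero))
  isCokernel : ∀ S : ShortComplex C, conflation S →
    Nonempty (IsColimit (CokernelCofork.ofπ S.g S.zero))
  inflation_id : ∀ A : C, IsInflation conflation (𝟙 A)
  deflation_id : ∀ A : C, IsDeflation conflation (𝟙 A)
  inflation_comp : ∀ {A B D : C} (i : A ⟶ B) (j : B ⟶ D),
    IsInflation conflation i → IsInflation conflation j → IsInflation conflation (i ≫ j)
  deflation_comp : ∀ {A B D : C} (p : A ⟶ B) (q : B ⟶ D),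
    IsDeflation conflation p → IsDeflation conflation q → IsDeflation conflation (p ≫ q)
  pushout : ∀ {A B A' : C} (i : A ⟶ B) (f : A ⟶ A'), IsInflation conflation i →
    ∃ (B' : C) (f' : B ⟶ B') (i' : A' ⟶ B'), IsPushout i f f' i' ∧ IsInflation conflation i'
  pullback : ∀ {B D D' : C} (p : B ⟶ D) (f : D' ⟶ D), IsDeflation conflation p →
    ∃ (B' : C) (f' : B' ⟶ B) (p' : B' ⟶ D'), IsPullback f' p' p f ∧ IsDeflation conflation p'

namespace ExactStructure

variable {C : Type u} [Category.{v} C] [Preadditive C] (S : ExactStructure C)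

/-- `i` is an inflation. -/
abbrev inflation {A B : C} (i : A ⟶ B) : Prop := IsInflation S.conflation i

/-- `p` is a deflation. -/
abbrev deflation {A B : C} (p : A ⟶ B) : Prop := IsDeflation S.conflation p

/-- The projective objects: morphisms out of them lift along deflations. -/
def proj : ObjectProperty C := fun Q =>
  ∀ ⦃A B : C⦄ (p : A ⟶ B), S.deflation p → ∀ f : Q ⟶ B, ∃ g : Q ⟶ A, g ≫ p = f

/-- The injective objects: morphisms into them extend along inflations. -/
def inj : ObjectProperty C := fun Q =>
  ∀ ⦃A B : C⦄ (i : A ⟶ B), S.inflation i → ∀ f : A ⟶ Q, ∃ g : B ⟶ Q, i ≫ g = f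

/-- Frobenius exact: enough projectives, enough injectives, and the two classes coincide. -/
structure IsFrobenius : Prop where
  enough_proj : ∀ X : C, ∃ (Q : C) (p : Q ⟶ X), S.proj Q ∧ S.deflation p
  enough_inj : ∀ X : C, ∃ (Q : C) (i : X ⟶ Q), S.inj Q ∧ S.inflation i
  proj_iff_inj : ∀ X : C, S.proj X ↔ S.inj X

/-- An extension of `X` by `Y`: a conflation `Y ⟶ Z ⟶ X`. -/
structure Extension (X Y : C) where
  mid : C
  i : Y ⟶ mid
  p : mid ⟶ X
  zero : i ≫ p = 0
  conflation : S.conflation (ShortComplex.mk i p zero)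

/-- Equivalence of extensions: an isomorphism of the middle terms compatible with the identities
of the outer terms. -/
def Extension.Equiv {S : ExactStructure C} {X Y : C} (e e' : S.Extension X Y) : Prop :=
  ∃ φ : e.mid ≅ e'.mid, e.i ≫ φ.hom = e'.i ∧ φ.hom ≫ e'.p = e.p

/-- (The underlying set of) `Ext¹(X, Y)`: extensions of `X` by `Y` up to equivalence. -/
def Ext1 (X Y : C) : Type (max u v) := Quot (Extension.Equiv (S := S) (X := X) (Y := Y))

/-- `Ext¹(X, Y) = 0`: all extensions of `X` by `Y` are equivalent (hence to the split one). -/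
def Ext1Vanishes (X Y : C) : Prop := Subsingleton (S.Ext1 X Y)

/-- Cluster-tilting subcategories, as full subcategories given by a class of objects `T`. (Closure
under isomorphism, finite direct sums and direct summands follows from the conditions.) -/
structure IsClusterTilting (T : ObjectProperty C) : Prop where
  rigid : ∀ X Y : C, T X → T Y → S.Ext1Vanishes X Y
  maximal : ∀ X : C, (∀ Y : C, T Y → S.Ext1Vanishes Y X) → T X
  functoriallyFinite : FunctoriallyFinite T

/-! ### The stable category and the cosyzygy functor -/

/-- The (underlying category of the) stable category: the additive quotient by the
projective(-injective) objects. -/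
abbrev Stable := AddQuotient S.proj

/-- The quotient functor to the stable category. -/
abbrev toStable : C ⥤ S.Stable := CategoryTheory.Quotient.functor (idealRel S.proj)

theorem toStable_map_eq_iff {X Y : C} (f g : X ⟶ Y) :
    S.toStable.map f = S.toStable.map g ↔ f - g ∈ factorIdeal S.proj X Y :=
  CategoryTheory.Quotient.functor_map_eq_iff (idealRel S.proj) f g

/-- A conflation `X ⟶ I ⟶ Z` with `I` injective. -/
structure InjHull (X : C) where
  I : C
  Z : C
  i : X ⟶ I
  p : I ⟶ Z
  zero : i ≫ p = 0
  conflation : S.conflation (ShortComplex.mk i p zero)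
  inj : S.inj I

variable {S}

theorem IsFrobenius.nonempty_injHull (hS : S.IsFrobenius) (X : C) : Nonempty (S.InjHull X) := by
  obtain ⟨I, i, hI, hi⟩ := hS.enough_inj X
  obtain ⟨Z, p, h, hc⟩ := hi
  exact ⟨⟨I, Z, i, p, h, hc, hI⟩⟩

/-- A chosen conflation `X ⟶ I ⟶ ΣX` with `I` injective. -/
noncomputable def IsFrobenius.hull (hS : S.IsFrobenius) (X : C) : S.InjHull X :=
  (hS.nonempty_injHull X).some

/-- `g` is the map induced on cosyzygies by `f` through some map of the middle terms. -/
def InjHull.Induces {X Y : C} (H : S.InjHull X) (K : S.InjHull Y) (f : X ⟶ Y) (g : H.Z ⟶ K.Z) :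
    Prop :=
  ∃ h : H.I ⟶ K.I, H.i ≫ h = f ≫ K.i ∧ H.p ≫ g = h ≫ K.p

theorem InjHull.exists_desc {X : C} (H : S.InjHull X) {W : C} (h : H.I ⟶ W) (w : H.i ≫ h = 0) :
    ∃ s : H.Z ⟶ W, H.p ≫ s = h := by
  obtain ⟨hc⟩ := S.isCokernel _ H.conflation
  exact ⟨hc.desc (CokernelCofork.ofπ h w), hc.fac _ WalkingParallelPair.one⟩

theorem InjHull.p_cancel {X : C} (H : S.InjHull X) {W : C} {g g' : H.Z ⟶ W}
    (w : H.p ≫ g = H.p ≫ g') : g = g' := by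
  obtain ⟨hc⟩ := S.isCokernel _ H.conflation
  exact Cofork.IsColimit.hom_ext hc w

theorem InjHull.inflation {X : C} (H : S.InjHull X) : S.inflation H.i :=
  ⟨_, _, H.zero, H.conflation⟩

theorem InjHull.exists_induces {X Y : C} (H : S.InjHull X) (K : S.InjHull Y) (f : X ⟶ Y) :
    ∃ g, H.Induces K f g := by
  obtain ⟨h, hh⟩ := K.inj H.i H.inflation (f ≫ K.i)
  obtain ⟨g, hg⟩ := H.exists_desc (h ≫ K.p) (by rw [reassoc_of% hh, K.zero, comp_zero])
  exact ⟨g, h, hh, hg⟩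

theorem InjHull.Induces.sub {X Y : C} {H : S.InjHull X} {K : S.InjHull Y} {f f' : X ⟶ Y}
    {g g' : H.Z ⟶ K.Z} (a : H.Induces K f g) (b : H.Induces K f' g') :
    H.Induces K (f - f') (g - g') := by
  obtain ⟨h, h₁, h₂⟩ := a
  obtain ⟨h', h₁', h₂'⟩ := b
  exact ⟨h - h', by simp [h₁, h₁'], by simp [h₂, h₂']⟩

theorem InjHull.Induces.comp {X Y W : C} {H : S.InjHull X} {K : S.InjHull Y} {L : S.InjHull W}
    {f : X ⟶ Y} {f' : Y ⟶ W} {g : H.Z ⟶ K.Z} {g' : K.Z ⟶ L.Z} (a : H.Induces K f g)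
    (b : K.Induces L f' g') : H.Induces L (f ≫ f') (g ≫ g') := by
  obtain ⟨h, h₁, h₂⟩ := a
  obtain ⟨h', h₁', h₂'⟩ := b
  exact ⟨h ≫ h', by simp [reassoc_of% h₁, h₁'], by simp [reassoc_of% h₂, h₂']⟩

theorem InjHull.Induces.mem_of_zero (hS : S.IsFrobenius) {X Y : C} {H : S.InjHull X}
    {K : S.InjHull Y} {g : H.Z ⟶ K.Z} (a : H.Induces K 0 g) :
    g ∈ factorIdeal S.proj H.Z K.Z := by
  obtain ⟨h, h₁, h₂⟩ := a
  obtain ⟨s, hs⟩ := H.exists_desc h (by rw [h₁, zero_comp])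
  refine AddSubgroup.subset_closure ⟨K.I, (hS.proj_iff_inj _).2 K.inj, s, K.p, ?_⟩
  apply H.p_cancel
  rw [h₂, reassoc_of% hs]

theorem InjHull.Induces.mem (hS : S.IsFrobenius) {X Y : C} {H : S.InjHull X} {K : S.InjHull Y}
    {f : X ⟶ Y} {g : H.Z ⟶ K.Z} (a : H.Induces K f g) (hf : f ∈ factorIdeal S.proj X Y) :
    g ∈ factorIdeal S.proj H.Z K.Z := by
  have key : ∃ g', H.Induces K f g' ∧ g' ∈ factorIdeal S.proj H.Z K.Z := by
    clear a
    induction hf using AddSubgroup.closure_induction with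
    | mem f hf =>
      obtain ⟨Q, hQ, c, d, rfl⟩ := hf
      obtain ⟨c', hc'⟩ := (hS.proj_iff_inj _).1 hQ H.i H.inflation c
      exact ⟨0, ⟨c' ≫ d ≫ K.i, by simp [reassoc_of% hc'], by simp [K.zero]⟩, zero_mem _⟩
    | zero => exact ⟨0, ⟨0, by simp, by simp⟩, zero_mem _⟩
    | add f f' _ _ hf hf' =>
      obtain ⟨g, ⟨h, h₁, h₂⟩, hg⟩ := hf
      obtain ⟨g', ⟨h', h₁', h₂'⟩, hg'⟩ := hf'
      exact ⟨g + g', ⟨h + h', by simp [h₁, h₁'], by simp [h₂, h₂']⟩, add_mem hg hg'⟩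
    | neg f _ hf =>
      obtain ⟨g, ⟨h, h₁, h₂⟩, hg⟩ := hf
      exact ⟨-g, ⟨-h, by simp [h₁], by simp [h₂]⟩, neg_mem hg⟩
  obtain ⟨g', a', hg'⟩ := key
  have h0 := a.sub a'
  rw [sub_self] at h0
  simpa using add_mem (h0.mem_of_zero hS) hg'

theorem InjHull.Induces.eq (hS : S.IsFrobenius) {X Y : C} {H : S.InjHull X} {K : S.InjHull Y}
    {f f' : X ⟶ Y} {g g' : H.Z ⟶ K.Z} (a : H.Induces K f g) (a' : H.Induces K f' g')
    (hf : f - f' ∈ factorIdeal S.proj X Y) : S.toStable.map g = S.toStable.map g' :=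
  (S.toStable_map_eq_iff g g').2 ((a.sub a').mem hS hf)

/-- A chosen map on cosyzygies induced by `f`. -/
noncomputable def IsFrobenius.cosyzygyMap (hS : S.IsFrobenius) {X Y : C} (f : X ⟶ Y) :
    (hS.hull X).Z ⟶ (hS.hull Y).Z :=
  ((hS.hull X).exists_induces (hS.hull Y) f).choose

theorem IsFrobenius.cosyzygyMap_induces (hS : S.IsFrobenius) {X Y : C} (f : X ⟶ Y) :
    (hS.hull X).Induces (hS.hull Y) f (hS.cosyzygyMap f) :=
  ((hS.hull X).exists_induces (hS.hull Y) f).choose_spec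

/-- The suspension `Σ` of the stable category: the cosyzygy functor, `ΣX` being the cokernel of an
inflation of `X` into an injective object. -/
noncomputable def IsFrobenius.suspension (hS : S.IsFrobenius) : S.Stable ⥤ S.Stable :=
  CategoryTheory.Quotient.lift (idealRel S.proj)
    { obj := fun X => S.toStable.obj (hS.hull X).Z
      map := fun f => S.toStable.map (hS.cosyzygyMap f)
      map_id := fun X => by
        rw [← S.toStable.map_id]
        exact (hS.cosyzygyMap_induces (𝟙 X)).eq hS (f' := 𝟙 X) ⟨𝟙 _, by simp, by simp⟩ (by simp)
      map_comp := fun f g => by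
        rw [← S.toStable.map_comp]
        exact (hS.cosyzygyMap_induces (f ≫ g)).eq hS
          ((hS.cosyzygyMap_induces f).comp (hS.cosyzygyMap_induces g)) (by simp) }
    (fun _ _ f g h => (hS.cosyzygyMap_induces f).eq hS (hS.cosyzygyMap_induces g) h)

end ExactStructure

/-- `F` satisfies Serre duality: there are `k`-linear isomorphisms
`Hom(X, Y) ≅ D Hom(Y, F X)`, natural in `X` and `Y`. -/
def SerreDuality (k : Type w) [Field k] {C : Type u} [Category.{v} C] [Preadditive C] [Linear k C]
    (F : C ⥤ C) : Prop :=
  ∃ e : ∀ X Y : C, (X ⟶ Y) ≃ₗ[k] Module.Dual k (Y ⟶ F.obj X),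
    ∀ {X X' Y Y' : C} (a : X' ⟶ X) (f : X ⟶ Y) (b : Y ⟶ Y') (h : Y' ⟶ F.obj X'),
      e X' Y' (a ≫ f ≫ b) h = e X Y f (b ≫ h ≫ F.map a)

/-- The stable category is 2-Calabi--Yau: `Σ²` is a Serre functor. (`Σ` is automatically an
autoequivalence of the stable category of a Frobenius exact category.) -/
def ExactStructure.IsTwoCalabiYau (k : Type w) [Field k] {C : Type u} [Category.{v} C]
    [Preadditive C] [Linear k C] {S : ExactStructure C} (hS : S.IsFrobenius) : Prop :=
  SerreDuality k (hS.suspension ⋙ hS.suspension)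

/-- For a full subcategory `T`, the quotient `T / P` by the ideal of morphisms factoring through
the objects of `P` that lie in `T`. -/
abbrev SubQuotient {C : Type u} [Category.{v} C] [Preadditive C] (T P : ObjectProperty C) :=
  AddQuotient (P.inverseImage T.ι)

end FrobeniusCT

/-!
Call a *trace* on a category a family of additive maps on endomorphism groups with
`tr (f ≫ g) = tr (g ≫ f)`. Since every object has a `T`-presentation `K ⟶ M ⟶ X` with `K` in `T`, a
trace on `T` extends to `C` by `tr f = tr f_M - tr f_K`; and since every finitely presented functor
has finite projective dimension, the same formula extends it further to `mod C`. On an abelian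
category a trace kills every nilpotent endomorphism: factor `f = e ≫ m` through its image and pass
to `m ≫ e`, which has smaller nilpotency index. Hence every trace on `T` kills the radical
endomorphisms, and an arrow violating the theorem is excluded by a trace that does not vanish on it.

* Loops: a functional on `End X` that kills the square of the radical in `T` is a trace concentrated
  at `X`, and it can be chosen nonzero on a given `f` in the radical but not in its square.
* 2-cycles: 2-Calabi–Yau duality yields almost split sequences `X ⟶ B₁ ⟶ K` and `K ⟶ B ⟶ X` with
  `B` and `B₁` in `T`. They leave no relation between paths of two arrows from `X` back to `X`, so
  functionals `α` on `X ⟶ Y` and `β` on `Y ⟶ X` killing the squared radical yield a functional `ψ`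
  on `End X` with `ψ (u ≫ v) = α u * β v`. With its analogue on `End Y` this is a trace, nonzero on
  the radical endomorphism `a ≫ b` of a 2-cycle.
-/

namespace FrobeniusCT

section Radical

variable {C : Type u} [Category.{v} C] [Preadditive C]

theorem isIso_id_sub_comp_of_swap {X Y : C} {f : X ⟶ Y} {g : Y ⟶ X} (h : IsIso (𝟙 X - f ≫ g)) :
    IsIso (𝟙 Y - g ≫ f) := by
  obtain ⟨a, h₁, h₂⟩ := h
  simp only [Preadditive.sub_comp, Preadditive.comp_sub, Category.id_comp, Category.comp_id,
    Category.assoc] at h₁ h₂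
  have hfga : f ≫ g ≫ a = a - 𝟙 X := by rw [← h₁]; abel
  have hafg : a ≫ f ≫ g = a - 𝟙 X := by rw [← h₂]; abel
  have hright := congrArg (fun x => g ≫ x ≫ f) hfga
  have hleft := congrArg (fun x => g ≫ x ≫ f) hafg
  simp only [Preadditive.sub_comp, Preadditive.comp_sub, Category.id_comp,
    Category.assoc] at hright hleft
  exact ⟨𝟙 Y + g ≫ a ≫ f, by simp [hright], by simp [hleft]⟩

theorem InRad.comp_right {X Y Z : C} {f : X ⟶ Y} (hf : InRad f) (g : Y ⟶ Z) : InRad (f ≫ g) :=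
  fun h => by simpa only [Category.assoc] using hf (g ≫ h)

theorem InRad.comp_left {X Y Z : C} (f : X ⟶ Y) {g : Y ⟶ Z} (hg : InRad g) : InRad (f ≫ g) :=
  fun h => by
    rw [Category.assoc]
    exact isIso_id_sub_comp_of_swap (by simpa only [Category.assoc] using hg (h ≫ f))

theorem InRad.add {X Y : C} {f f' : X ⟶ Y} (hf : InRad f) (hf' : InRad f') : InRad (f + f') := by
  intro g
  have := hf g
  have := hf' (g ≫ inv (𝟙 X - f ≫ g))
  have hfactor : 𝟙 X - (f + f') ≫ g
      = (𝟙 X - f' ≫ g ≫ inv (𝟙 X - f ≫ g)) ≫ (𝟙 X - f ≫ g) := by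
    rw [Preadditive.sub_comp, Category.assoc, Category.assoc, IsIso.inv_hom_id, Category.comp_id,
      Category.id_comp, Preadditive.add_comp]
    abel
  rw [hfactor]
  infer_instance

theorem inRad_zero (X Y : C) : InRad (0 : X ⟶ Y) := fun g => by
  rw [zero_comp, sub_zero]
  infer_instance

theorem InRad.smul {k : Type w} [Field k] [Linear k C] {X Y : C} {f : X ⟶ Y} (hf : InRad f)
    (c : k) : InRad (c • f) := by
  simpa using hf.comp_right (c • 𝟙 Y)

/-- The radical `rad(X, Y)` as a subspace of the space of morphisms. -/
def radSubmodule (k : Type w) [Field k] [Linear k C] (X Y : C) : Submodule k (X ⟶ Y) where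
  carrier := {f | InRad f}
  add_mem' := InRad.add
  zero_mem' := inRad_zero X Y
  smul_mem' c _ hf := InRad.smul hf c

theorem InRad.of_biprod_lift [HasBinaryBiproducts C] {X Y Z : C} {f : X ⟶ Y} {g : X ⟶ Z}
    (hf : InRad f) (hg : InRad g) : InRad (biprod.lift f g) := by
  rw [biprod.lift_eq]
  exact (hf.comp_right _).add (hg.comp_right _)

theorem InRad.of_biprod_desc [HasBinaryBiproducts C] {X Y Z : C} {f : Y ⟶ X} {g : Z ⟶ X}
    (hf : InRad f) (hg : InRad g) : InRad (biprod.desc f g) := by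
  rw [biprod.desc_eq]
  exact (hf.comp_left _).add (hg.comp_left _)

/-- `f` is a composite of two radical morphisms through an object of `T`. For `X`, `Y` in `T` this
is membership in the square of the radical of the full subcategory `T`. -/
def RadSqThrough (T : ObjectProperty C) {X Y : C} (f : X ⟶ Y) : Prop :=
  ∃ (Z : C) (g : X ⟶ Z) (h : Z ⟶ Y), T Z ∧ InRad g ∧ InRad h ∧ f = g ≫ h

/-- The composites of two radical morphisms through `T` as a subspace; closure of `T` under direct
sums makes single composites, rather than sums of such, closed under addition. -/
def radSqSubmodule (k : Type w) [Field k] [Linear k C] [HasBinaryBiproducts C]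
    (T : ObjectProperty C) (hT : ∀ Y Z, T Y → T Z → T (Y ⊞ Z)) {X : C} (hX : T X) (Y : C) :
    Submodule k (X ⟶ Y) where
  carrier := {f | RadSqThrough T f}
  add_mem' := by
    rintro _ _ ⟨Z, g, h, hZ, hg, hh, rfl⟩ ⟨Z', g', h', hZ', hg', hh', rfl⟩
    exact ⟨Z ⊞ Z', biprod.lift g g', biprod.desc h h', hT _ _ hZ hZ', hg.of_biprod_lift hg',
      hh.of_biprod_desc hh', (biprod.lift_desc ..).symm⟩
  zero_mem' := ⟨X, 0, 0, hX, inRad_zero _ _, inRad_zero _ _, comp_zero.symm⟩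
  smul_mem' := by
    rintro c _ ⟨Z, g, h, hZ, hg, hh, rfl⟩
    exact ⟨Z, c • g, h, hZ, hg.smul c, hh, (Linear.smul_comp ..).symm⟩

theorem exists_functional_of_not_radSqThrough {k : Type w} [Field k] [Linear k C]
    [HasBinaryBiproducts C] {T : ObjectProperty C} (hT : ∀ Y Z, T Y → T Z → T (Y ⊞ Z)) {X Y : C}
    (hX : T X) {f : X ⟶ Y} (hf : ¬ RadSqThrough T f) :
    ∃ α : (X ⟶ Y) →ₗ[k] k, α f ≠ 0 ∧ ∀ g, RadSqThrough T g → α g = 0 := by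
  obtain ⟨α, hαf, hα⟩ :=
    Submodule.exists_le_ker_of_notMem (p := radSqSubmodule k T hT hX Y) (v := f) hf
  exact ⟨α, hαf, fun _ hg => hα hg⟩

theorem InRad.isNilpotent {X : C} [IsArtinianRing (End X)] {f : X ⟶ X} (hf : InRad f) :
    IsNilpotent (End.of f) := by
  obtain ⟨n, hn⟩ := IsArtinianRing.isNilpotent_jacobson_bot (R := End X)
  have hmem : End.of f ∈ Ideal.jacobson (⊥ : Ideal (End X)) := by
    refine Ideal.mem_jacobson_iff.2 fun g => ?_
    obtain ⟨z, hz, -⟩ := hf (-g : X ⟶ X)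
    rw [Preadditive.comp_neg, sub_neg_eq_add, Preadditive.add_comp, Category.id_comp,
      Category.assoc] at hz
    refine ⟨End.of z, sub_eq_zero.2 ?_⟩
    rw [add_comm]
    exact hz
  refine ⟨n, ?_⟩
  have := Ideal.pow_mem_pow hmem n
  rw [hn] at this
  exact this

end Radical

section LocalObjects

variable {C : Type u} [Category.{v} C] [Preadditive C]

theorem isIso_or_isIso_id_sub {X : C} [IsLocalRing (End X)] (f : X ⟶ X) :
    IsIso f ∨ IsIso (𝟙 X - f) := by
  have := IsLocalRing.isUnit_or_isUnit_of_add_one (a := End.of f) (b := End.of (𝟙 X - f))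
    (add_sub_cancel (End.of f) 1)
  simpa only [isUnit_iff_isIso] using this

theorem id_ne_zero_of_isLocalRing (X : C) [IsLocalRing (End X)] : 𝟙 X ≠ 0 :=
  one_ne_zero (α := End X)

theorem InRad.not_isIso {X Y : C} {f : X ⟶ Y} (hf : InRad f) (hX : 𝟙 X ≠ 0) : ¬ IsIso f := by
  intro h
  have := hf (inv f)
  rw [IsIso.hom_inv_id, sub_self] at this
  exact hX (by rw [← IsIso.hom_inv_id (0 : X ⟶ X), zero_comp])

theorem isIso_of_comp_eq_id {X Y : C} [IsLocalRing (End Y)] {f : X ⟶ Y} {g : Y ⟶ X}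
    (h : f ≫ g = 𝟙 X) (hX : 𝟙 X ≠ 0) : IsIso f := by
  rcases isIso_or_isIso_id_sub (g ≫ f) with h' | h'
  · refine ⟨g, h, ?_⟩
    rw [← cancel_epi (g ≫ f)]
    simp only [Category.assoc, reassoc_of% h, Category.comp_id]
  · have hzero : f ≫ (𝟙 Y - g ≫ f) = 0 := by simp [reassoc_of% h]
    refine absurd ?_ hX
    rw [← h, (cancel_mono (𝟙 Y - g ≫ f)).1 (hzero.trans zero_comp.symm), zero_comp]

theorem exists_retraction_of_not_inRad {X Y : C} [IsLocalRing (End X)] {f : X ⟶ Y}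
    (hf : ¬ InRad f) : ∃ g : Y ⟶ X, f ≫ g = 𝟙 X := by
  obtain ⟨g, hg⟩ := not_forall.1 hf
  have := (isIso_or_isIso_id_sub (f ≫ g)).resolve_right hg
  exact ⟨g ≫ inv (f ≫ g), by rw [← Category.assoc, IsIso.hom_inv_id]⟩

theorem exists_section_of_not_inRad {X Y : C} [IsLocalRing (End Y)] {f : X ⟶ Y}
    (hf : ¬ InRad f) : ∃ g : Y ⟶ X, g ≫ f = 𝟙 Y := by
  obtain ⟨g, hg⟩ := not_forall.1 hf
  have := (isIso_or_isIso_id_sub (g ≫ f)).resolve_right fun h => hg (isIso_id_sub_comp_of_swap h)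
  exact ⟨inv (g ≫ f) ≫ g, by rw [Category.assoc, IsIso.inv_hom_id]⟩

theorem inRad_of_isEmpty_iso {X Y : C} [IsLocalRing (End X)] [IsLocalRing (End Y)]
    (h : IsEmpty (X ≅ Y)) (f : X ⟶ Y) : InRad f := by
  by_contra hf
  obtain ⟨g, hg⟩ := exists_retraction_of_not_inRad hf
  have := isIso_of_comp_eq_id hg (id_ne_zero_of_isLocalRing X)
  exact h.false (asIso f)

theorem inRad_iff_not_isIso {X : C} [IsLocalRing (End X)] (f : X ⟶ X) :
    InRad f ↔ ¬ IsIso f := by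
  refine ⟨fun h => h.not_isIso (id_ne_zero_of_isLocalRing X), fun h => ?_⟩
  by_contra hf
  obtain ⟨g, hg⟩ := exists_retraction_of_not_inRad hf
  exact h (isIso_of_comp_eq_id hg (id_ne_zero_of_isLocalRing X))

variable {k : Type w} [Field k] [Linear k C]

theorem exists_inRad_sub_smul_id [IsAlgClosed k] {X : C} [IsLocalRing (End X)]
    [Module.Finite k (X ⟶ X)] (f : X ⟶ X) : ∃ c : k, InRad (f - c • 𝟙 X) := by
  have : FiniteDimensional k (End X) := inferInstanceAs (Module.Finite k (X ⟶ X))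
  obtain ⟨c, hc⟩ := spectrum.nonempty_of_isAlgClosed_of_finiteDimensional k (End.of f)
  rw [spectrum.mem_iff, ← IsUnit.neg_iff, isUnit_iff_isIso, neg_sub,
    Algebra.algebraMap_eq_smul_one] at hc
  exact ⟨c, (inRad_iff_not_isIso _).2 hc⟩

/-- `r` is the residue map `End X → End X / rad = k` of an object with local endomorphism ring. -/
structure IsResidueMap {X : C} (r : (X ⟶ X) →ₗ[k] k) : Prop where
  map_id : r (𝟙 X) = 1
  eq_zero_iff : ∀ f, r f = 0 ↔ InRad f

theorem IsResidueMap.inRad_sub_smul_id {X : C} {r : (X ⟶ X) →ₗ[k] k} (hr : IsResidueMap r)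
    (f : X ⟶ X) : InRad (f - r f • 𝟙 X) := by
  rw [← hr.eq_zero_iff, map_sub, map_smul, hr.map_id, smul_eq_mul, mul_one, sub_self]

theorem exists_isResidueMap (k : Type w) [Field k] [IsAlgClosed k] [Linear k C] (X : C)
    [IsLocalRing (End X)] [Module.Finite k (X ⟶ X)] :
    ∃ r : (X ⟶ X) →ₗ[k] k, IsResidueMap r := by
  have hid : 𝟙 X ∉ radSubmodule k X X := fun h =>
    InRad.not_isIso h (id_ne_zero_of_isLocalRing X) inferInstance
  obtain ⟨φ, hφ, hrad⟩ := Submodule.exists_le_ker_of_notMem hid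
  refine ⟨(φ (𝟙 X))⁻¹ • φ, by simp [hφ], fun f => ?_⟩
  simp only [LinearMap.smul_apply, smul_eq_mul, mul_eq_zero, inv_eq_zero, hφ, false_or]
  refine ⟨fun hf => ?_, fun hf => hrad hf⟩
  obtain ⟨c, hc⟩ := exists_inRad_sub_smul_id (k := k) f
  have hc0 : φ (f - c • 𝟙 X) = 0 := hrad hc
  rw [map_sub, hf, zero_sub, neg_eq_zero, map_smul, smul_eq_mul, mul_eq_zero] at hc0
  simpa [hc0.resolve_right hφ] using hc

end LocalObjects

section Trace

/-- A trace on the objects in `D` with values in an abelian group: additive maps on endomorphism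
groups satisfying `tr (f g) = tr (g f)`. -/
structure TraceOn {C : Type u} [Category.{v} C] [Preadditive C] (D : ObjectProperty C)
    (V : Type w) [AddCommGroup V] where
  val {X : C} (hX : D X) : (X ⟶ X) →+ V
  comm {X Y : C} (hX : D X) (hY : D Y) (f : X ⟶ Y) (g : Y ⟶ X) :
    val hX (f ≫ g) = val hY (g ≫ f)

variable {V : Type w} [AddCommGroup V]

/-- The restriction of a trace to a smaller class of objects. -/
def TraceOn.restrict {C : Type u} [Category.{v} C] [Preadditive C] {D D' : ObjectProperty C}
    (τ : TraceOn D V) (h : D' ≤ D) : TraceOn D' V where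
  val hX := τ.val (h _ hX)
  comm hX hY := τ.comm (h _ hX) (h _ hY)

section SumRetract

universe u₁ v₁ u₂ v₂

variable {B : Type u₁} [Category.{v₁} B] [Preadditive B]
  {A : Type u₂} [Category.{v₂} A] [Preadditive A]

/-- A presentation of `Z` as a retract of the finite direct sum of the objects `G.obj (Y l)` with
`Y l` in `D`. The direct sum itself is not required to exist. -/
structure SumRetract (G : B ⥤ A) (D : ObjectProperty B) (Z : A) where
  n : ℕ
  Y : Fin n → B
  mem : ∀ l, D (Y l)
  ι : ∀ l, G.obj (Y l) ⟶ Z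
  π : ∀ l, Z ⟶ G.obj (Y l)
  sum_eq_id : ∑ l, π l ≫ ι l = 𝟙 Z

variable {G : B ⥤ A} [G.Full] [G.Faithful] [G.Additive] {D : ObjectProperty B}

namespace SumRetract

theorem sum_preimage_comp_preimage {W W' : B} {Z : A} (R : SumRetract G D Z) (a : G.obj W ⟶ Z)
    (b : Z ⟶ G.obj W') :
    ∑ l, G.preimage (a ≫ R.π l) ≫ G.preimage (R.ι l ≫ b) = G.preimage (a ≫ b) := by
  apply G.map_injective
  calc G.map (∑ l, G.preimage (a ≫ R.π l) ≫ G.preimage (R.ι l ≫ b))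
      = a ≫ (∑ l, R.π l ≫ R.ι l) ≫ b := by
        simp [Functor.map_sum, Preadditive.sum_comp, Preadditive.comp_sum]
    _ = G.map (G.preimage (a ≫ b)) := by rw [R.sum_eq_id, Category.id_comp, G.map_preimage]

/-- The value on endomorphisms of `Z` of the extension of a trace on `D`, computed from a
presentation of `Z` as a retract of a direct sum. -/
noncomputable def trace {Z : A} (R : SumRetract G D Z) (τ : TraceOn D V) : (Z ⟶ Z) →+ V :=
  AddMonoidHom.mk' (fun f => ∑ l, τ.val (R.mem l) (G.preimage (R.ι l ≫ f ≫ R.π l))) fun f g => by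
    rw [← Finset.sum_add_distrib]
    refine Finset.sum_congr rfl fun l _ => ?_
    rw [← map_add]
    exact congrArg (τ.val (R.mem l)) (G.map_injective (by simp [Functor.map_add]))

theorem trace_apply {Z : A} (R : SumRetract G D Z) (τ : TraceOn D V) (f : Z ⟶ Z) :
    R.trace τ f = ∑ l, τ.val (R.mem l) (G.preimage (R.ι l ≫ f ≫ R.π l)) :=
  rfl

theorem trace_comp_comm {Z Z' : A} (R : SumRetract G D Z) (R' : SumRetract G D Z')
    (τ : TraceOn D V) (f : Z ⟶ Z') (g : Z' ⟶ Z) : R.trace τ (f ≫ g) = R'.trace τ (g ≫ f) := by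
  have expand {Z Z' : A} (R : SumRetract G D Z) (R' : SumRetract G D Z') (f : Z ⟶ Z')
      (g : Z' ⟶ Z) : R.trace τ (f ≫ g) = ∑ l, ∑ l', τ.val (R.mem l)
        (G.preimage (R.ι l ≫ f ≫ R'.π l') ≫ G.preimage (R'.ι l' ≫ g ≫ R.π l)) := by
    rw [trace_apply]
    refine Finset.sum_congr rfl fun l _ => ?_
    rw [← map_sum]
    simpa only [Category.assoc] using congrArg (τ.val (R.mem l))
      (R'.sum_preimage_comp_preimage (R.ι l ≫ f) (g ≫ R.π l)).symm
  rw [expand R R', expand R' R, Finset.sum_comm]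
  exact Finset.sum_congr rfl fun l' _ => Finset.sum_congr rfl fun l _ =>
    τ.comm (R.mem l) (R'.mem l') _ _

theorem trace_map {X : B} (hX : D X) (R : SumRetract G D (G.obj X)) (τ : TraceOn D V)
    (f : X ⟶ X) : R.trace τ (G.map f) = τ.val hX f := by
  calc ∑ l, τ.val (R.mem l) (G.preimage (R.ι l ≫ G.map f ≫ R.π l))
      = ∑ l, τ.val (R.mem l) (G.preimage (R.ι l ≫ 𝟙 _) ≫ G.preimage (G.map f ≫ R.π l)) := by
        refine Finset.sum_congr rfl fun l _ => congrArg _ (G.map_injective ?_)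
        simp
    _ = ∑ l, τ.val hX (G.preimage (G.map f ≫ R.π l) ≫ G.preimage (R.ι l ≫ 𝟙 _)) :=
        Finset.sum_congr rfl fun l _ => τ.comm (R.mem l) hX _ _
    _ = τ.val hX f := by
        rw [← map_sum, R.sum_preimage_comp_preimage, Category.comp_id, G.preimage_map]

end SumRetract

theorem TraceOn.exists_extend_sumRetract (G : B ⥤ A) [G.Full] [G.Faithful] [G.Additive]
    (τ : TraceOn D V) :
    ∃ τ' : TraceOn (fun Z => Nonempty (SumRetract G D Z)) V,
      ∀ {X : B} (hX : D X) (hGX : Nonempty (SumRetract G D (G.obj X))) (f : X ⟶ X),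
        τ'.val hGX (G.map f) = τ.val hX f :=
  ⟨{ val := fun hZ => hZ.some.trace τ
     comm := fun hZ hZ' => hZ.some.trace_comp_comm hZ'.some τ },
    fun hX hGX => hGX.some.trace_map hX τ⟩

end SumRetract

section ApproxPresentation

variable {C : Type u} [Category.{v} C] [Preadditive C] {D Q : ObjectProperty C}

/-- A presentation `K ⟶ P ⟶ F` with `K` in `D`, where `p : P ⟶ F` is a right `Q`-approximation with
kernel `i : K ⟶ P`. -/
structure ApproxPresentation (D Q : ObjectProperty C) (F : C) where
  K : C
  P : C
  i : K ⟶ P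
  p : P ⟶ F
  memK : D K
  memP : Q P
  zero : i ≫ p = 0
  mono : Mono i
  exists_factor_i : ∀ {W : C} (a : W ⟶ P), a ≫ p = 0 → ∃ b, b ≫ i = a
  exists_factor_p : ∀ {M : C}, Q M → ∀ a : M ⟶ F, ∃ b, b ≫ p = a

namespace ApproxPresentation

/-- `(f₀, f₁)` is a map of presentations over `f`. -/
def Lifts {F F' : C} (R : ApproxPresentation D Q F) (R' : ApproxPresentation D Q F') (f : F ⟶ F')
    (f₀ : R.P ⟶ R'.P) (f₁ : R.K ⟶ R'.K) : Prop :=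
  f₀ ≫ R'.p = R.p ≫ f ∧ f₁ ≫ R'.i = R.i ≫ f₀

theorem exists_lifts {F F' : C} (R : ApproxPresentation D Q F) (R' : ApproxPresentation D Q F')
    (f : F ⟶ F') : ∃ f₀ f₁, R.Lifts R' f f₀ f₁ := by
  obtain ⟨f₀, hf₀⟩ := R'.exists_factor_p R.memP (R.p ≫ f)
  obtain ⟨f₁, hf₁⟩ := R'.exists_factor_i (R.i ≫ f₀)
    (by rw [Category.assoc, hf₀, reassoc_of% R.zero, zero_comp])
  exact ⟨f₀, f₁, hf₀, hf₁⟩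

variable {F F' F'' : C} {R : ApproxPresentation D Q F} {R' : ApproxPresentation D Q F'}
  {R'' : ApproxPresentation D Q F''}

theorem Lifts.comp {f : F ⟶ F'} {g : F' ⟶ F''} {f₀ : R.P ⟶ R'.P} {f₁ : R.K ⟶ R'.K}
    {g₀ : R'.P ⟶ R''.P} {g₁ : R'.K ⟶ R''.K} (hf : R.Lifts R' f f₀ f₁)
    (hg : R'.Lifts R'' g g₀ g₁) : R.Lifts R'' (f ≫ g) (f₀ ≫ g₀) (f₁ ≫ g₁) :=
  ⟨by rw [Category.assoc, hg.1, reassoc_of% hf.1], by rw [Category.assoc, hg.2, reassoc_of% hf.2]⟩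

theorem Lifts.add {f f' : F ⟶ F'} {f₀ f₀' : R.P ⟶ R'.P} {f₁ f₁' : R.K ⟶ R'.K}
    (h : R.Lifts R' f f₀ f₁) (h' : R.Lifts R' f' f₀' f₁') :
    R.Lifts R' (f + f') (f₀ + f₀') (f₁ + f₁') :=
  ⟨by rw [Preadditive.add_comp, h.1, h'.1, Preadditive.comp_add],
    by rw [Preadditive.add_comp, h.2, h'.2, Preadditive.comp_add]⟩

/-- Two lifts of an endomorphism differ by a homotopy `s`, on whose two composites with `i` the
trace agrees. -/
theorem Lifts.val_sub_val_eq (hQ : Q ≤ D) (τ : TraceOn D V) {f : F ⟶ F} {f₀ f₀' : R.P ⟶ R.P}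
    {f₁ f₁' : R.K ⟶ R.K} (h : R.Lifts R f f₀ f₁) (h' : R.Lifts R f f₀' f₁') :
    τ.val (hQ _ R.memP) f₀ - τ.val R.memK f₁ = τ.val (hQ _ R.memP) f₀' - τ.val R.memK f₁' := by
  obtain ⟨s, hs⟩ := R.exists_factor_i (f₀ - f₀')
    (by rw [Preadditive.sub_comp, h.1, h'.1, sub_self])
  have := R.mono
  have hs' : R.i ≫ s = f₁ - f₁' := by
    rw [← cancel_mono R.i, Category.assoc, hs, Preadditive.comp_sub, Preadditive.sub_comp,
      h.2, h'.2]
  rw [sub_eq_sub_iff_sub_eq_sub, ← map_sub, ← map_sub, ← hs, ← hs']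
  exact τ.comm _ _ s R.i

/-- The value on endomorphisms of `F` of the extension of a trace on `D`, as an Euler
characteristic over a presentation of `F`. -/
noncomputable def trace (R : ApproxPresentation D Q F) (hQ : Q ≤ D) (τ : TraceOn D V) :
    (F ⟶ F) →+ V :=
  AddMonoidHom.mk' (fun f => τ.val (hQ _ R.memP) (R.exists_lifts R f).choose -
      τ.val R.memK (R.exists_lifts R f).choose_spec.choose) fun f g => by
    rw [(R.exists_lifts R (f + g)).choose_spec.choose_spec.val_sub_val_eq hQ τ
      ((R.exists_lifts R f).choose_spec.choose_spec.add
        (R.exists_lifts R g).choose_spec.choose_spec), map_add, map_add]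
    abel

theorem Lifts.trace_eq (hQ : Q ≤ D) (τ : TraceOn D V) {f : F ⟶ F} {f₀ : R.P ⟶ R.P}
    {f₁ : R.K ⟶ R.K} (h : R.Lifts R f f₀ f₁) :
    R.trace hQ τ f = τ.val (hQ _ R.memP) f₀ - τ.val R.memK f₁ :=
  (R.exists_lifts R f).choose_spec.choose_spec.val_sub_val_eq hQ τ h

theorem trace_comp_comm (R : ApproxPresentation D Q F) (R' : ApproxPresentation D Q F')
    (hQ : Q ≤ D) (τ : TraceOn D V) (f : F ⟶ F') (g : F' ⟶ F) :
    R.trace hQ τ (f ≫ g) = R'.trace hQ τ (g ≫ f) := by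
  obtain ⟨f₀, f₁, hf⟩ := R.exists_lifts R' f
  obtain ⟨g₀, g₁, hg⟩ := R'.exists_lifts R g
  rw [(hf.comp hg).trace_eq hQ τ, (hg.comp hf).trace_eq hQ τ,
    τ.comm (hQ _ R.memP) (hQ _ R'.memP), τ.comm R.memK R'.memK]

theorem trace_eq_val (R : ApproxPresentation D Q F) (hF : Q F) (hQ : Q ≤ D) (τ : TraceOn D V)
    (f : F ⟶ F) : R.trace hQ τ f = τ.val (hQ _ hF) f := by
  obtain ⟨s, hs⟩ := R.exists_factor_p hF (𝟙 F)
  have hlift : R.Lifts R f (R.p ≫ f ≫ s) 0 :=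
    ⟨by rw [Category.assoc, Category.assoc, hs, Category.comp_id],
      by rw [zero_comp, reassoc_of% R.zero, zero_comp]⟩
  rw [hlift.trace_eq hQ τ, map_zero, sub_zero, τ.comm _ (hQ _ hF), Category.assoc, hs,
    Category.comp_id]

end ApproxPresentation

theorem TraceOn.exists_extend_approxPresentation (hQ : Q ≤ D) (τ : TraceOn D V) :
    ∃ τ' : TraceOn (fun F => Nonempty (ApproxPresentation D Q F)) V,
      ∀ {X : C} (hX : Q X) (hX' : Nonempty (ApproxPresentation D Q X)) (f : X ⟶ X),
        τ'.val hX' f = τ.val (hQ _ hX) f :=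
  ⟨{ val := fun hF => hF.some.trace hQ τ
     comm := fun hF hF' => hF.some.trace_comp_comm hF'.some hQ τ },
    fun hX hX' => hX'.some.trace_eq_val hX hQ τ⟩

end ApproxPresentation

end Trace

section AbelianTrace

variable {A : Type u} [Category.{v} A] [Abelian A] {V : Type w} [AddCommGroup V]

theorem hasProjectiveDimensionLE_of_projective {X : A} (hX : Projective X) (n : ℕ) :
    HasProjectiveDimensionLE X n :=
  hasProjectiveDimensionLT_of_ge X 1 (n + 1) (by omega)

theorem nonempty_approxPresentation_projective [EnoughProjectives A] {n : ℕ} {X : A}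
    (hX : HasProjectiveDimensionLE X (n + 1)) :
    Nonempty (ApproxPresentation (fun Y : A => HasProjectiveDimensionLE Y n)
      (fun Y : A => Projective Y) X) := by
  have hS : (ShortComplex.mk (kernel.ι (Projective.π X)) (Projective.π X)
    (kernel.condition _)).ShortExact := { exact := ShortComplex.exact_kernel _ }
  exact ⟨{
    K := kernel (Projective.π X)
    P := Projective.over X
    i := kernel.ι _
    p := Projective.π X
    memK := (hS.hasProjectiveDimensionLT_X₃_iff n (Projective.projective_over X)).1 hX
    memP := Projective.projective_over X
    zero := kernel.condition _
    mono := inferInstance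
    exists_factor_i := fun a ha => ⟨kernel.lift _ a ha, kernel.lift_ι _ _ _⟩
    exists_factor_p := fun hM a => ⟨hM.factors a (Projective.π X) |>.choose,
      (hM.factors a (Projective.π X)).choose_spec⟩ }⟩

theorem TraceOn.exists_extend_projectiveDimension [EnoughProjectives A]
    (τ : TraceOn (fun X : A => Projective X) V) (n : ℕ) :
    ∃ τ' : TraceOn (fun X : A => HasProjectiveDimensionLE X n) V,
      ∀ {X : A} (hX : Projective X) (f : X ⟶ X),
        τ'.val (hasProjectiveDimensionLE_of_projective hX n) f = τ.val hX f := by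
  induction n with
  | zero =>
    exact ⟨τ.restrict fun X => (projective_iff_hasProjectiveDimensionLE_zero X).2,
      fun _ _ => rfl⟩
  | succ n ih =>
    obtain ⟨τ₁, h₁⟩ := ih
    obtain ⟨τ₂, h₂⟩ := τ₁.exists_extend_approxPresentation
      fun _ hX => hasProjectiveDimensionLE_of_projective hX n
    exact ⟨τ₂.restrict fun _ => nonempty_approxPresentation_projective,
      fun hX f => (h₂ hX _ f).trans (h₁ hX f)⟩

theorem comp_end_pow {C : Type u} [Category.{v} C] {X Y : C} (e : X ⟶ Y) (m : Y ⟶ X) (n : ℕ) :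
    e ≫ (End.of (m ≫ e) ^ n).asHom = (End.of (e ≫ m) ^ n).asHom ≫ e := by
  induction n with
  | zero => exact (Category.comp_id e).trans (Category.id_comp e).symm
  | succ n ih =>
    calc e ≫ (m ≫ e) ≫ (End.of (m ≫ e) ^ n).asHom
        = (e ≫ m) ≫ e ≫ (End.of (m ≫ e) ^ n).asHom := by simp only [Category.assoc]
      _ = ((e ≫ m) ≫ (End.of (e ≫ m) ^ n).asHom) ≫ e := by rw [ih]; simp only [Category.assoc]

/-- Replacing `f = e m`, factored through its image, by `m e` lowers the order of nilpotency. -/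
theorem TraceOn.val_eq_zero_of_pow_eq_zero (τ : TraceOn (⊤ : ObjectProperty A) V) (n : ℕ) {X : A}
    (f : X ⟶ X) (hf : End.of f ^ n = 0) : τ.val (X := X) trivial f = 0 := by
  induction n generalizing X with
  | zero =>
    have hid : 𝟙 X = 0 := hf
    rw [← Category.id_comp f, hid, zero_comp, map_zero]
  | succ n ih =>
    let e := Abelian.factorThruImage f
    let m := Abelian.image.ι f
    have hfac : e ≫ m = f := Abelian.image.fac f
    rw [← hfac, τ.comm trivial trivial]
    refine ih _ ((cancel_mono m).1 ((cancel_epi e).1 ?_))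
    calc e ≫ (End.of (m ≫ e) ^ n).asHom ≫ m
        = (End.of (e ≫ m) ^ n).asHom ≫ e ≫ m := by
          rw [← Category.assoc, comp_end_pow, Category.assoc]
      _ = (End.of f ^ (n + 1)).asHom := by rw [hfac, pow_succ', End.mul_def]
      _ = e ≫ 0 ≫ m := by rw [hf, zero_comp, comp_zero]

end AbelianTrace

section FinPres

variable {C : Type u} [Category.{v} C] [Preadditive C]

instance additive_preadditiveYoneda :
    (preadditiveYoneda : C ⥤ Cᵒᵖ ⥤ AddCommGrpCat.{v}).Additive where
  map_add {X Y f g} := by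
    ext W a
    exact Preadditive.comp_add _ _ _ (a : W.unop ⟶ X) f g

theorem preadditiveYoneda_hom_ext {X : C} {G : Cᵒᵖ ⥤ AddCommGrpCat.{v}}
    {a b : preadditiveYoneda.obj X ⟶ G}
    (h : (a.app (.op X)).hom (𝟙 X : X ⟶ X) = (b.app (.op X)).hom (𝟙 X : X ⟶ X)) : a = b := by
  have app_eq (c : preadditiveYoneda.obj X ⟶ G) {W : Cᵒᵖ} (g : W.unop ⟶ X) :
      (c.app W).hom g = (G.map g.op).hom ((c.app (.op X)).hom (𝟙 X : X ⟶ X)) :=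
    (congrArg (c.app W).hom (Category.comp_id g).symm).trans
      (ConcreteCategory.congr_hom (c.naturality g.op) (𝟙 X : X ⟶ X))
  ext W (g : W.unop ⟶ X)
  exact (app_eq a g).trans ((congrArg _ h).trans (app_eq b g).symm)

theorem exists_yoneda_map_comp_eq {X Z : C} {G : Cᵒᵖ ⥤ AddCommGrpCat.{v}}
    (r : preadditiveYoneda.obj Z ⟶ G) [Epi r] (a : preadditiveYoneda.obj X ⟶ G) :
    ∃ z : X ⟶ Z, preadditiveYoneda.map z ≫ r = a := by
  have hsurj := (AddCommGrpCat.epi_iff_surjective (r.app (.op X))).1 inferInstance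
  obtain ⟨z, hz⟩ := hsurj ((a.app (.op X)).hom (𝟙 X : X ⟶ X))
  refine ⟨(z : X ⟶ Z), preadditiveYoneda_hom_ext (Eq.trans ?_ hz)⟩
  exact congrArg (r.app (.op X)).hom (Category.id_comp (z : X ⟶ Z))

theorem isFinPres_yoneda (X : C) : isFinPres C (preadditiveYoneda.obj X) :=
  ⟨X, X, 0, ⟨cokernelZeroIsoTarget.symm ≪≫
    cokernelIsoOfEq (preadditiveYoneda.map_zero X X).symm⟩⟩

/-- The Yoneda embedding into the category of finitely presented functors. -/
abbrev yonedaFinPres (C : Type u) [Category.{v} C] [Preadditive C] : C ⥤ ModCat C :=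
  (isFinPres C).lift preadditiveYoneda isFinPres_yoneda

theorem exists_epi_from_yoneda (F : ModCat C) :
    ∃ (Z : C) (r : preadditiveYoneda.obj Z ⟶ F.obj), Epi r := by
  obtain ⟨X, Y, f, ⟨e⟩⟩ := F.property
  exact ⟨Y, cokernel.π _ ≫ e.inv, inferInstance⟩

theorem isFinPres_cokernel [HasBinaryBiproducts C] {F G : Cᵒᵖ ⥤ AddCommGrpCat.{v}} {Z : C}
    (r : preadditiveYoneda.obj Z ⟶ F) [Epi r] (hG : isFinPres C G) (q : F ⟶ G) :
    isFinPres C (cokernel q) := by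
  obtain ⟨X, Y, f, ⟨e⟩⟩ := hG
  obtain ⟨p, hp⟩ : ∃ p, p = cokernel.π (preadditiveYoneda.map f) ≫ e.inv := ⟨_, rfl⟩
  have hfp : preadditiveYoneda.map f ≫ p = 0 := by simp [hp]
  have : Epi p := hp ▸ inferInstance
  obtain ⟨z, hz⟩ := exists_yoneda_map_comp_eq p (r ≫ q)
  let d : X ⊞ Z ⟶ Y := biprod.desc f z
  have hd : preadditiveYoneda.map d ≫ p ≫ cokernel.π q = 0 := by
    have hd_eq : d = biprod.fst ≫ f + biprod.snd ≫ z := biprod.desc_eq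
    rw [hd_eq, Functor.map_add, Functor.map_comp, Functor.map_comp, Preadditive.add_comp,
      Category.assoc, Category.assoc, reassoc_of% hfp, zero_comp, comp_zero, zero_add,
      reassoc_of% hz, cokernel.condition, comp_zero, comp_zero]
  have hcolim : IsColimit (CokernelCofork.ofπ (p ≫ cokernel.π q) hd) :=
    CokernelCofork.IsColimit.ofπ' _ _ fun {W} k hk => by
      have hfk : preadditiveYoneda.map f ≫ k = 0 := by
        rw [← biprod.inl_desc f z, Functor.map_comp, Category.assoc, hk, comp_zero]
      have hzk : preadditiveYoneda.map z ≫ k = 0 := by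
        rw [← biprod.inr_desc f z, Functor.map_comp, Category.assoc, hk, comp_zero]
      let k' : G ⟶ W := e.hom ≫ cokernel.desc _ k hfk
      have hpk : p ≫ k' = k := by simp [hp, k']
      have hqk : q ≫ k' = 0 := by
        rw [← cancel_epi r, ← reassoc_of% hz, hpk, hzk, comp_zero]
      exact ⟨cokernel.desc q k' hqk, by rw [Category.assoc, cokernel.π_desc, hpk]⟩
  exact ⟨_, _, d, ⟨hcolim.coconePointUniqueUpToIso (colimit.isColimit _)⟩⟩

theorem epi_hom_of_epi [HasBinaryBiproducts C] {F G : ModCat C} (q : F ⟶ G) [Epi q] :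
    Epi q.hom := by
  obtain ⟨Z, r, hr⟩ := exists_epi_from_yoneda F
  let π : G ⟶ ⟨cokernel q.hom, isFinPres_cokernel r G.property q.hom⟩ :=
    ObjectProperty.homMk (cokernel.π q.hom)
  have hqπ : q ≫ π = 0 := (isFinPres C).hom_ext (cokernel.condition q.hom)
  have hπ : π = 0 := by rw [← cancel_epi q, hqπ, comp_zero]
  exact Abelian.epi_of_cokernel_π_eq_zero _ (congrArg InducedCategory.Hom.hom hπ)

theorem projective_yonedaFinPres [HasBinaryBiproducts C] (X : C) :
    Projective ((yonedaFinPres C).obj X) where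
  factors {F G} a q hq := by
    obtain ⟨Z, r, hr⟩ := exists_epi_from_yoneda F
    have := epi_hom_of_epi q
    obtain ⟨z, hz⟩ := exists_yoneda_map_comp_eq (r ≫ q.hom) a.hom
    exact ⟨ObjectProperty.homMk (preadditiveYoneda.map z ≫ r),
      (isFinPres C).hom_ext ((Category.assoc _ _ _).trans hz)⟩

theorem exists_epi_from_yonedaFinPres (F : ModCat C) :
    ∃ (Z : C) (r : (yonedaFinPres C).obj Z ⟶ F), Epi r := by
  obtain ⟨Z, r, hr⟩ := exists_epi_from_yoneda F
  refine ⟨Z, ObjectProperty.homMk r, ⟨fun a b h => (isFinPres C).hom_ext ?_⟩⟩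
  exact (cancel_epi r).1 (congrArg InducedCategory.Hom.hom h)

theorem enoughProjectives_modCat [HasBinaryBiproducts C] : EnoughProjectives (ModCat C) where
  presentation F := by
    obtain ⟨Z, r, hr⟩ := exists_epi_from_yonedaFinPres F
    have := projective_yonedaFinPres Z
    exact ⟨{ p := (yonedaFinPres C).obj Z, f := r }⟩

theorem nonempty_sumRetract_of_projective {F : ModCat C} (hF : Projective F) :
    Nonempty (SumRetract (yonedaFinPres C) ⊤ F) := by
  obtain ⟨Z, r, hr⟩ := exists_epi_from_yonedaFinPres F
  exact ⟨{ n := 1, Y := fun _ => Z, mem := fun _ => trivial, ι := fun _ => r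
           π := fun _ => Projective.factorThru (𝟙 F) r, sum_eq_id := by simp }⟩

theorem TraceOn.val_eq_zero_of_finiteGlobalDimension [HasBinaryBiproducts C]
    (hab : IsAbelian (ModCat C)) (hgl : hab.FiniteGlobalDimension) {V : Type w} [AddCommGroup V]
    (τ : TraceOn (⊤ : ObjectProperty C) V) {X : C} {f : X ⟶ X} (hf : IsNilpotent (End.of f)) :
    τ.val (X := X) trivial f = 0 := by
  let _ := hab.toAbelian
  let y := yonedaFinPres C
  obtain ⟨n, hn⟩ := hgl
  have := enoughProjectives_modCat (C := C)
  obtain ⟨τ₁, h₁⟩ := τ.exists_extend_sumRetract y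
  obtain ⟨τ₂, h₂⟩ := (τ₁.restrict fun F (hF : Projective F) =>
    nonempty_sumRetract_of_projective hF).exists_extend_projectiveDimension n
  obtain ⟨m, hm⟩ := hf
  have hym : End.of (y.map f) ^ m = 0 := by
    calc End.of (y.map f) ^ m = y.mapEnd X (End.of f ^ m) :=
          (map_pow (y.mapEnd X) (End.of f) m).symm
      _ = 0 := by rw [hm]; exact y.map_zero X X
  have hyX := projective_yonedaFinPres X
  calc τ.val trivial f = τ₁.val (nonempty_sumRetract_of_projective hyX) (y.map f) :=
        (h₁ trivial _ f).symm
    _ = τ₂.val (hasProjectiveDimensionLE_of_projective hyX n) (y.map f) := (h₂ hyX _).symm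
    _ = 0 := (τ₂.restrict fun F _ => hn F).val_eq_zero_of_pow_eq_zero m (y.map f) hym

end FinPres

namespace ExactStructure

variable {C : Type u} [Category.{v} C] [Preadditive C] {S : ExactStructure C}

namespace Extension

variable {X K : C} (e : S.Extension X K)

theorem inflation : S.inflation e.i := ⟨X, e.p, e.zero, e.conflation⟩

theorem deflation : S.deflation e.p := ⟨K, e.i, e.zero, e.conflation⟩

instance mono_i : Mono e.i := by
  obtain ⟨hk⟩ := S.isKernel _ e.conflation
  exact ⟨fun _ _ h => Fork.IsLimit.hom_ext hk h⟩

instance epi_p : Epi e.p := by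
  obtain ⟨hc⟩ := S.isCokernel _ e.conflation
  exact ⟨fun _ _ h => Cofork.IsColimit.hom_ext hc h⟩

theorem exists_lift {W : C} (a : W ⟶ e.mid) (ha : a ≫ e.p = 0) : ∃ b : W ⟶ K, b ≫ e.i = a := by
  obtain ⟨hk⟩ := S.isKernel _ e.conflation
  exact ⟨hk.lift (KernelFork.ofι a ha), hk.fac _ WalkingParallelPair.zero⟩

theorem exists_desc {W : C} (a : e.mid ⟶ W) (ha : e.i ≫ a = 0) : ∃ b : X ⟶ W, e.p ≫ b = a := by
  obtain ⟨hc⟩ := S.isCokernel _ e.conflation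
  exact ⟨hc.desc (CokernelCofork.ofπ a ha), hc.fac _ WalkingParallelPair.one⟩

theorem exists_pullback {Y : C} (f : Y ⟶ X) :
    ∃ (e' : S.Extension Y K) (f' : e'.mid ⟶ e.mid), e'.i ≫ f' = e.i ∧ IsPullback f' e'.p e.p f := by
  obtain ⟨B, f', p', pb, Z, j, hj, hc⟩ := S.pullback e.p f e.deflation
  let e₀ : S.Extension Y Z := ⟨B, j, p', hj, hc⟩
  let i' : K ⟶ B := pb.lift e.i 0 (by rw [e.zero, zero_comp])
  have hi' : i' ≫ p' = 0 := pb.lift_snd _ _ _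
  obtain ⟨a, ha⟩ := e.exists_lift (j ≫ f') (by rw [Category.assoc, pb.w, reassoc_of% hj, zero_comp])
  obtain ⟨b, hb⟩ := e₀.exists_lift i' hi'
  have := e₀.mono_i
  have hab : a ≫ b = 𝟙 Z := by
    rw [← cancel_mono e₀.i, Category.assoc, hb, Category.id_comp]
    apply pb.hom_ext <;> simp [i', e₀, ha, hj]
  have hba : b ≫ a = 𝟙 K := by
    rw [← cancel_mono e.i, Category.assoc, ha, reassoc_of% hb, pb.lift_fst, Category.id_comp]
  refine ⟨⟨B, i', p', hi', S.of_iso ?_ hc⟩, f', pb.lift_fst _ _ _, pb⟩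
  exact ShortComplex.isoMk ⟨a, b, hab, hba⟩ (Iso.refl _) (Iso.refl _)
    (by simp [← hb, reassoc_of% hab, e₀]) (by simp)

theorem exists_pushout {K' : C} (f : K ⟶ K') :
    ∃ (e' : S.Extension X K') (f' : e.mid ⟶ e'.mid), f' ≫ e'.p = e.p ∧ IsPushout e.i f f' e'.i := by
  obtain ⟨B, f', i', po, Z, q, hq, hc⟩ := S.pushout e.i f e.inflation
  let e₀ : S.Extension Z K' := ⟨B, i', q, hq, hc⟩
  let p' : B ⟶ X := po.desc e.p 0 (by rw [e.zero, comp_zero])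
  have hp' : i' ≫ p' = 0 := po.inr_desc _ _ _
  obtain ⟨a, ha⟩ := e.exists_desc (f' ≫ q)
    (by rw [← Category.assoc, po.w, Category.assoc, hq, comp_zero])
  obtain ⟨b, hb⟩ := e₀.exists_desc p' hp'
  have := e₀.epi_p
  have hab : a ≫ b = 𝟙 X := by
    rw [← cancel_epi e.p, reassoc_of% ha, hb, po.inl_desc, Category.comp_id]
  have hba : b ≫ a = 𝟙 Z := by
    rw [← cancel_epi e₀.p, reassoc_of% hb, Category.comp_id]
    apply po.hom_ext <;> simp [p', e₀, ha, hq]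
  refine ⟨⟨B, i', p', hp', S.of_iso ?_ hc⟩, f', po.inl_desc _ _ _, po⟩
  exact ShortComplex.isoMk (Iso.refl _) (Iso.refl _) ⟨b, a, hba, hab⟩ (by simp) (by simp [← hb, e₀])

theorem nonempty_splitting (hi : IsSplitMono e.i) :
    Nonempty (ShortComplex.mk e.i e.p e.zero).Splitting := by
  obtain ⟨s, hs⟩ := e.exists_desc (𝟙 _ - retraction e.i ≫ e.i) (by simp)
  refine ⟨{ r := retraction e.i, s := s, f_r := IsSplitMono.id _, s_g := ?_, id := ?_ }⟩
  · rw [← cancel_epi e.p, reassoc_of% hs]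
    simp [e.zero]
  · simp [hs]

theorem Equiv.isSplitMono_iff {e e' : S.Extension X K} (h : e.Equiv e') :
    IsSplitMono e.i ↔ IsSplitMono e'.i := by
  obtain ⟨φ, hφ, -⟩ := h
  constructor <;> intro
  · exact hφ ▸ inferInstance
  · have : e.i = e'.i ≫ φ.inv := by rw [← hφ, Category.assoc, φ.hom_inv_id, Category.comp_id]
    exact this ▸ inferInstance

theorem isSplitMono_iff_of_eqvGen {e e' : S.Extension X K}
    (h : Relation.EqvGen Extension.Equiv e e') : IsSplitMono e.i ↔ IsSplitMono e'.i := by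
  induction h with
  | rel _ _ h => exact h.isSplitMono_iff
  | refl => exact Iff.rfl
  | symm _ _ _ ih => exact ih.symm
  | trans _ _ _ _ _ ih ih' => exact ih.trans ih'

theorem equiv_of_isSplitMono [HasBinaryBiproducts C] {e e' : S.Extension X K}
    (h : IsSplitMono e.i) (h' : IsSplitMono e'.i) : e.Equiv e' := by
  obtain ⟨σ⟩ := e.nonempty_splitting h
  obtain ⟨σ'⟩ := e'.nonempty_splitting h'
  refine ⟨σ.isoBinaryBiproduct ≪≫ σ'.isoBinaryBiproduct.symm, ?_, ?_⟩
  · have : e.i ≫ σ.r = 𝟙 K := σ.f_r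
    simp [ShortComplex.Splitting.isoBinaryBiproduct, biprod.lift_desc, reassoc_of% this,
      reassoc_of% e.zero]
  · have : σ'.s ≫ e'.p = 𝟙 X := σ'.s_g
    simp [ShortComplex.Splitting.isoBinaryBiproduct, biprod.lift_desc, this, e'.zero]

end Extension

section Biproduct

variable [HasBinaryBiproducts C]

variable (S) in
theorem conflation_biprod (X Y : C) :
    S.conflation (ShortComplex.mk (biprod.inl : X ⟶ X ⊞ Y) biprod.snd (by simp)) := by
  obtain ⟨Z, q, hq, hc⟩ := S.inflation_id X
  obtain rfl : q = 0 := by simpa only [Category.id_comp] using hq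
  let e : S.Extension Z X := ⟨X, 𝟙 X, 0, hq, hc⟩
  obtain ⟨e', f, hf, -⟩ := e.exists_pullback (0 : Y ⟶ Z)
  obtain ⟨σ⟩ := e'.nonempty_splitting (IsSplitMono.mk' ⟨f, hf⟩)
  have hr : e'.i ≫ σ.r = 𝟙 X := σ.f_r
  refine S.of_iso ?_ e'.conflation
  refine ShortComplex.isoMk (Iso.refl _) σ.isoBinaryBiproduct (Iso.refl _) ?_ ?_
  · ext <;> simp [ShortComplex.Splitting.isoBinaryBiproduct, hr, e'.zero]
  · simp [ShortComplex.Splitting.isoBinaryBiproduct]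

variable (S) in
theorem deflation_desc_id {X Y : C} (f : X ⟶ Y) : S.deflation (biprod.desc f (𝟙 Y)) := by
  let φ : X ⊞ Y ≅ X ⊞ Y :=
    { hom := biprod.desc (biprod.lift (𝟙 X) (-f)) biprod.inr
      inv := biprod.desc (biprod.lift (𝟙 X) f) biprod.inr
      hom_inv_id := by ext <;> simp
      inv_hom_id := by ext <;> simp }
  refine ⟨X, biprod.lift (𝟙 X) (-f), by simp, S.of_iso ?_ (S.conflation_biprod X Y)⟩
  refine ShortComplex.isoMk (Iso.refl _) φ (Iso.refl _) ?_ ?_ <;> ext <;> simp [φ]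

theorem deflation_map_id (M : C) {Q X : C} {q : Q ⟶ X} (hq : S.deflation q) :
    S.deflation (biprod.map (𝟙 M) q) := by
  obtain ⟨K, i, hiq, hc⟩ := hq
  let e : S.Extension X K := ⟨Q, i, q, hiq, hc⟩
  obtain ⟨e', f, -, pb⟩ := e.exists_pullback (biprod.snd : M ⊞ X ⟶ X)
  have hfq : f ≫ q = e'.p ≫ biprod.snd := pb.w
  let φ : e'.mid ≅ M ⊞ Q :=
    { hom := biprod.lift (e'.p ≫ biprod.fst) f
      inv := pb.lift biprod.snd (biprod.map (𝟙 M) q) (by simp [e])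
      hom_inv_id := by
        apply pb.hom_ext
        · simp [e]
        · ext <;> simp [hfq]
      inv_hom_id := by ext <;> simp }
  refine ⟨K, e'.i ≫ φ.hom, ?_, S.of_iso ?_ e'.conflation⟩
  · ext <;> simp [φ, hfq, reassoc_of% e'.zero]
  · exact ShortComplex.isoMk (Iso.refl _) φ (Iso.refl _) (by simp)
      (by ext <;> simp [φ, hfq])

theorem deflation_desc {M Q X : C} (f : M ⟶ X) {q : Q ⟶ X} (hq : S.deflation q) :
    S.deflation (biprod.desc f q) := by
  have h : biprod.desc f q = biprod.map (𝟙 M) q ≫ biprod.desc f (𝟙 X) := by ext <;> simp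
  exact h ▸ S.deflation_comp _ _ (deflation_map_id M hq) (S.deflation_desc_id f)

variable (S) in
theorem ext1Vanishes_iff (X K : C) :
    S.Ext1Vanishes X K ↔ ∀ e : S.Extension X K, IsSplitMono e.i := by
  constructor
  · intro h e
    let e₀ : S.Extension X K := ⟨K ⊞ X, biprod.inl, biprod.snd, _, S.conflation_biprod K X⟩
    have heq : Quot.mk Extension.Equiv e₀ = Quot.mk Extension.Equiv e := h.elim _ _
    exact (Extension.isSplitMono_iff_of_eqvGen (Quot.eqvGen_exact heq)).1
      (inferInstanceAs (IsSplitMono biprod.inl))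
  · intro h
    refine ⟨fun a b => ?_⟩
    induction a using Quot.ind with | _ e
    induction b using Quot.ind with | _ e'
    exact Quot.sound (Extension.equiv_of_isSplitMono (h e) (h e'))

theorem Ext1Vanishes.exists_extend {X Z : C} (h : S.Ext1Vanishes X Z) {K : C}
    (e : S.Extension X K) (f : K ⟶ Z) : ∃ g : e.mid ⟶ Z, e.i ≫ g = f := by
  obtain ⟨e', f', -, po⟩ := e.exists_pushout f
  have := (S.ext1Vanishes_iff X Z).1 h e'
  exact ⟨f' ≫ retraction e'.i, by rw [reassoc_of% po.w, IsSplitMono.id, Category.comp_id]⟩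

theorem Ext1Vanishes.exists_lift {Z K : C} (h : S.Ext1Vanishes Z K) {X : C}
    (e : S.Extension X K) (f : Z ⟶ X) : ∃ g : Z ⟶ e.mid, g ≫ e.p = f := by
  obtain ⟨e', f', -, pb⟩ := e.exists_pullback f
  obtain ⟨σ⟩ := e'.nonempty_splitting ((S.ext1Vanishes_iff Z K).1 h e')
  have hs : σ.s ≫ e'.p = 𝟙 Z := σ.s_g
  exact ⟨σ.s ≫ f', by rw [Category.assoc, pb.w, reassoc_of% hs]⟩

end Biproduct

section FactorIdeal

theorem exists_lift_of_mem_factorIdeal {X Y : C} {f : X ⟶ Y} (hf : f ∈ factorIdeal S.proj X Y)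
    {D : C} (p : D ⟶ Y) (hp : S.deflation p) : ∃ g : X ⟶ D, g ≫ p = f := by
  induction hf using AddSubgroup.closure_induction with
  | mem f hf =>
    obtain ⟨Q, hQ, a, b, rfl⟩ := hf
    obtain ⟨g, hg⟩ := hQ p hp b
    exact ⟨a ≫ g, by rw [Category.assoc, hg]⟩
  | zero => exact ⟨0, zero_comp⟩
  | add f f' _ _ hf hf' =>
    obtain ⟨g, hg⟩ := hf
    obtain ⟨g', hg'⟩ := hf'
    exact ⟨g + g', by rw [Preadditive.add_comp, hg, hg']⟩
  | neg f _ hf =>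
    obtain ⟨g, hg⟩ := hf
    exact ⟨-g, by rw [Preadditive.neg_comp, hg]⟩

theorem comp_mem_factorIdeal {P : ObjectProperty C} {X Q Y : C} (hQ : P Q) (a : X ⟶ Q)
    (b : Q ⟶ Y) : a ≫ b ∈ factorIdeal P X Y :=
  AddSubgroup.subset_closure ⟨Q, hQ, a, b, rfl⟩

namespace InjHull

/-- The conflation of an injective hull, regarded as an extension. -/
abbrev toExtension {X : C} (H : S.InjHull X) : S.Extension H.Z X :=
  ⟨H.I, H.i, H.p, H.zero, H.conflation⟩

theorem proj (hS : S.IsFrobenius) {X : C} (H : S.InjHull X) : S.proj H.I :=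
  (hS.proj_iff_inj _).2 H.inj

/-- The cosyzygy functor is faithful on the stable category. -/
theorem Induces.mem_of_mem (hS : S.IsFrobenius) {X Y : C} {H : S.InjHull X} {K : S.InjHull Y}
    {f : X ⟶ Y} {g : H.Z ⟶ K.Z} (a : H.Induces K f g) (hg : g ∈ factorIdeal S.proj H.Z K.Z) :
    f ∈ factorIdeal S.proj X Y := by
  obtain ⟨h, h₁, h₂⟩ := a
  obtain ⟨m, hm⟩ := exists_lift_of_mem_factorIdeal hg _ K.toExtension.deflation
  obtain ⟨n, hn⟩ := K.toExtension.exists_lift (h - H.p ≫ m) (by simp [hm, h₂])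
  have := K.toExtension.mono_i
  have hf : f = H.i ≫ n := by
    rw [← cancel_mono K.i, Category.assoc, hn, Preadditive.comp_sub, h₁,
      reassoc_of% H.zero, zero_comp, sub_zero]
  exact hf ▸ comp_mem_factorIdeal (H.proj hS) _ _

/-- The cosyzygy functor is full. -/
theorem exists_induces_of_hom (hS : S.IsFrobenius) {X Y : C} (H : S.InjHull X) (K : S.InjHull Y)
    (g : H.Z ⟶ K.Z) : ∃ f, H.Induces K f g := by
  obtain ⟨l, hl⟩ := H.proj hS K.p K.toExtension.deflation (H.p ≫ g)
  obtain ⟨f, hf⟩ := K.toExtension.exists_lift (H.i ≫ l)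
    (by rw [Category.assoc, hl, reassoc_of% H.zero, zero_comp])
  exact ⟨f, l, hf.symm, hl.symm⟩

end InjHull

end FactorIdeal

namespace IsClusterTilting

variable {C : Type u} [Category.{v} C] [Preadditive C] [HasBinaryBiproducts C]
  {S : ExactStructure C} {T : ObjectProperty C}

theorem of_forall_isSplitMono (hT : S.IsClusterTilting T) {X : C}
    (h : ∀ Y, T Y → ∀ e : S.Extension Y X, IsSplitMono e.i) : T X :=
  hT.maximal X fun Y hY => (S.ext1Vanishes_iff Y X).2 (h Y hY)

theorem of_proj (hT : S.IsClusterTilting T) (hS : S.IsFrobenius) {Q : C} (hQ : S.proj Q) : T Q :=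
  hT.of_forall_isSplitMono fun _ _ e =>
    have ⟨r, hr⟩ := (hS.proj_iff_inj Q).1 hQ e.i e.inflation (𝟙 Q)
    IsSplitMono.mk' ⟨r, hr⟩

theorem isStableUnderRetracts (hT : S.IsClusterTilting T) : T.IsStableUnderRetracts where
  of_retract {X Z} ρ hZ := hT.of_forall_isSplitMono fun Y hY e =>
    have ⟨g, hg⟩ := (hT.rigid Y Z hY hZ).exists_extend e ρ.i
    IsSplitMono.mk' ⟨g ≫ ρ.r, by rw [reassoc_of% hg, ρ.retract]⟩

theorem biprod (hT : S.IsClusterTilting T) {X Z : C} (hX : T X) (hZ : T Z) : T (X ⊞ Z) :=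
  hT.of_forall_isSplitMono fun Y hY e => by
    obtain ⟨g, hg⟩ := (hT.rigid Y X hY hX).exists_extend e biprod.fst
    obtain ⟨g', hg'⟩ := (hT.rigid Y Z hY hZ).exists_extend e biprod.snd
    exact IsSplitMono.mk' ⟨biprod.lift g g', by ext <;> simp [hg, hg']⟩

theorem of_extension (hT : S.IsClusterTilting T) {X K : C} (e : S.Extension X K) (hM : T e.mid)
    (he : ∀ N, T N → ∀ g : N ⟶ X, ∃ h : N ⟶ e.mid, h ≫ e.p = g) : T K :=
  hT.of_forall_isSplitMono fun Y hY e' => by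
    obtain ⟨g, hg⟩ := (hT.rigid Y e.mid hY hM).exists_extend e' e.i
    obtain ⟨m, hm⟩ := e'.exists_desc (g ≫ e.p) (by rw [reassoc_of% hg, e.zero])
    obtain ⟨h, hh⟩ := he Y hY m
    obtain ⟨r, hr⟩ := e.exists_lift (g - e'.p ≫ h) (by simp [hh, hm])
    refine IsSplitMono.mk' ⟨r, ?_⟩
    rw [← cancel_mono e.i, Category.assoc, hr]
    simp [hg, reassoc_of% e'.zero]

theorem exists_approx (hT : S.IsClusterTilting T) (hS : S.IsFrobenius) (X : C) :
    ∃ (K : C) (e : S.Extension X K), T K ∧ T e.mid ∧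
      ∀ N, T N → ∀ g : N ⟶ X, ∃ h : N ⟶ e.mid, h ≫ e.p = g := by
  obtain ⟨M, f, hM, hf⟩ := hT.functoriallyFinite.1 X
  obtain ⟨Q, q, hQ, hq⟩ := hS.enough_proj X
  obtain ⟨K, i, hi, hc⟩ := deflation_desc f hq
  let e : S.Extension X K := ⟨M ⊞ Q, i, biprod.desc f q, hi, hc⟩
  have hMQ : T e.mid := hT.biprod hM (hT.of_proj hS hQ)
  have he (N : C) (hN : T N) (g : N ⟶ X) : ∃ h : N ⟶ e.mid, h ≫ e.p = g := by
    obtain ⟨h, hh⟩ := hf N hN g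
    exact ⟨h ≫ biprod.inl, by simp [e, hh]⟩
  exact ⟨K, e, hT.of_extension e hMQ he, hMQ, he⟩

theorem nonempty_approxPresentation (hT : S.IsClusterTilting T) (hS : S.IsFrobenius) (X : C) :
    Nonempty (ApproxPresentation T T X) := by
  obtain ⟨K, e, hK, hM, he⟩ := hT.exists_approx hS X
  exact ⟨{ K := K, P := e.mid, i := e.i, p := e.p, memK := hK, memP := hM, zero := e.zero,
           mono := e.mono_i, exists_factor_i := fun a ha => e.exists_lift a ha,
           exists_factor_p := fun hM a => he _ hM a }⟩

theorem trace_eq_zero (hT : S.IsClusterTilting T) (hS : S.IsFrobenius)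
    (hab : IsAbelian (ModCat C)) (hgl : hab.FiniteGlobalDimension) {V : Type w} [AddCommGroup V]
    (τ : TraceOn T V) {X : C} (hX : T X) {f : X ⟶ X} (hf : IsNilpotent (End.of f)) :
    τ.val hX f = 0 := by
  obtain ⟨τ', h⟩ := τ.exists_extend_approxPresentation le_rfl
  have hap (X : C) (_ : (⊤ : ObjectProperty C) X) := hT.nonempty_approxPresentation hS X
  rw [← h hX (hap X trivial)]
  exact (τ'.restrict hap).val_eq_zero_of_finiteGlobalDimension hab hgl hf

end IsClusterTilting

end ExactStructure

section LinearAlgebra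

variable {k V W : Type*} [Field k] [AddCommGroup V] [Module k V] [AddCommGroup W] [Module k W]

theorem exists_functional_comp_eq (L : V →ₗ[k] W) (φ : V →ₗ[k] k)
    (h : LinearMap.ker L ≤ LinearMap.ker φ) : ∃ ψ : W →ₗ[k] k, ∀ x, ψ (L x) = φ x := by
  have hφ : φ ∈ LinearMap.range L.dualMap := by
    rw [LinearMap.range_dualMap_eq_dualAnnihilator_ker, Submodule.mem_dualAnnihilator]
    exact fun x hx => h hx
  obtain ⟨ψ, rfl⟩ := hφ
  exact ⟨ψ, fun _ => rfl⟩

theorem exists_eq_of_forall_apply_eq_zero [Module.Finite k W] (B : V →ₗ[k] Module.Dual k W)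
    (φ : Module.Dual k W) (hφ : ∀ w, (∀ v, B v w = 0) → φ w = 0) : ∃ v, B v = φ := by
  change φ ∈ LinearMap.range B
  rw [← Subspace.dualCoannihilator_dualAnnihilator_eq (W := LinearMap.range B),
    Submodule.mem_dualAnnihilator]
  exact fun w hw => hφ w fun v => (Submodule.mem_dualCoannihilator _).1 hw _ ⟨v, rfl⟩

end LinearAlgebra

theorem IsResidueMap.exists_eq_comp {k : Type w} [Field k] {C : Type u} [Category.{v} C]
    [Preadditive C] [Linear k C] {X : C} [IsLocalRing (End X)] {r : (X ⟶ X) →ₗ[k] k}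
    (hr : IsResidueMap r) {Z : C} [Module.Finite k (Z ⟶ X)] (φ : (Z ⟶ X) →ₗ[k] k)
    (hφ : ∀ h, InRad h → φ h = 0) : ∃ g : X ⟶ Z, ∀ h, φ h = r (g ≫ h) := by
  let B : (X ⟶ Z) →ₗ[k] Module.Dual k (Z ⟶ X) :=
    LinearMap.mk₂ k (fun g h => r (g ≫ h)) (by simp) (by simp) (by simp) (by simp)
  obtain ⟨g, hg⟩ := exists_eq_of_forall_apply_eq_zero B φ fun h hh => hφ h <| by
    by_contra hrad
    obtain ⟨g, hg⟩ := exists_section_of_not_inRad hrad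
    have hrg : r (g ≫ h) = 0 := hh g
    rw [hg, hr.map_id] at hrg
    exact one_ne_zero hrg
  exact ⟨g, fun h => (LinearMap.congr_fun hg h).symm⟩

namespace ExactStructure

variable {k : Type w} [Field k] {C : Type u} [Category.{v} C] [Preadditive C] [Linear k C]
  {S : ExactStructure C} {hS : S.IsFrobenius}

/-- The chosen cosyzygy `ΣX`, as an object of the exact category. -/
noncomputable abbrev IsFrobenius.cosyzygy (hS : S.IsFrobenius) (X : C) : C := (hS.hull X).Z

/-- Serre duality of the stable category for the functor `Σ²`, written as a pairing of morphisms of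
the exact category; its kernels on both sides are the morphisms factoring through projectives. -/
structure SerrePairing (k : Type w) [Field k] [Linear k C] (hS : S.IsFrobenius) where
  D (X Y : C) : (X ⟶ Y) →ₗ[k] (Y ⟶ hS.cosyzygy (hS.cosyzygy X)) →ₗ[k] k
  comp_left {X X' Y : C} (a : X' ⟶ X) (f : X ⟶ Y) (h : Y ⟶ hS.cosyzygy (hS.cosyzygy X')) :
    D X' Y (a ≫ f) h = D X Y f (h ≫ hS.cosyzygyMap (hS.cosyzygyMap a))
  comp_right {X Y Y' : C} (f : X ⟶ Y) (b : Y ⟶ Y') (h : Y' ⟶ hS.cosyzygy (hS.cosyzygy X)) :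
    D X Y' (f ≫ b) h = D X Y f (b ≫ h)
  left_eq_zero_iff {X Y : C} (f : X ⟶ Y) :
    (∀ h, D X Y f h = 0) ↔ f ∈ factorIdeal S.proj X Y
  right_eq_zero_iff {X Y : C} (h : Y ⟶ hS.cosyzygy (hS.cosyzygy X)) :
    (∀ f, D X Y f h = 0) ↔ h ∈ factorIdeal S.proj Y (hS.cosyzygy (hS.cosyzygy X))

/-- The quotient functor to the stable category as a linear map on morphisms. -/
def toStableLinear (k : Type w) [Field k] [Linear k C] (S : ExactStructure C) (X Y : C) :
    (X ⟶ Y) →ₗ[k] (S.toStable.obj X ⟶ S.toStable.obj Y) where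
  toFun f := S.toStable.map f
  map_add' _ _ := Functor.map_add _
  map_smul' _ _ := rfl

theorem toStableLinear_eq_zero_iff {X Y : C} (f : X ⟶ Y) :
    toStableLinear k S X Y f = 0 ↔ f ∈ factorIdeal S.proj X Y := by
  have := S.toStable_map_eq_iff f 0
  rwa [Functor.map_zero, sub_zero] at this

theorem toStableLinear_surjective (X Y : C) : Function.Surjective (toStableLinear k S X Y) :=
  S.toStable.map_surjective

theorem IsTwoCalabiYau.nonempty_serrePairing (hCY : IsTwoCalabiYau k hS) :
    Nonempty (SerrePairing k hS) := by
  obtain ⟨e, he⟩ := hCY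
  let D (X Y : C) : (X ⟶ Y) →ₗ[k] (Y ⟶ hS.cosyzygy (hS.cosyzygy X)) →ₗ[k] k :=
    (toStableLinear k S Y _).dualMap ∘ₗ
      (e (S.toStable.obj X) (S.toStable.obj Y)).toLinearMap ∘ₗ toStableLinear k S X Y
  have hD {X X' Y Y' : C} (a : X' ⟶ X) (f : X ⟶ Y) (b : Y ⟶ Y')
      (h : Y' ⟶ hS.cosyzygy (hS.cosyzygy X')) :
      D X' Y' (a ≫ f ≫ b) h = D X Y f (b ≫ h ≫ hS.cosyzygyMap (hS.cosyzygyMap a)) :=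
    he (S.toStable.map a) (S.toStable.map f) (S.toStable.map b) (S.toStable.map h)
  refine ⟨⟨D, fun a f h => ?_, fun {X Y Y'} f b h => ?_, fun {X Y} f => ?_, fun {X Y} h => ?_⟩⟩
  · simpa only [Category.comp_id, Category.id_comp] using hD a f (𝟙 _) h
  · have hcomp (h' : S.toStable.obj Y' ⟶ (hS.suspension ⋙ hS.suspension).obj (S.toStable.obj X)) :
        e _ _ (S.toStable.map f ≫ S.toStable.map b) h' =
          e _ _ (S.toStable.map f) (S.toStable.map b ≫ h') := by
      simpa using he (𝟙 _) (S.toStable.map f) (S.toStable.map b) h'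
    exact hcomp (S.toStable.map h)
  · rw [← toStableLinear_eq_zero_iff (k := k),
      ← (e (S.toStable.obj X) (S.toStable.obj Y)).map_eq_zero_iff, LinearMap.ext_iff]
    exact ((toStableLinear_surjective (k := k) (S := S) Y (hS.cosyzygy (hS.cosyzygy X))).forall
      (p := fun h => e _ _ (toStableLinear k S X Y f) h = 0)).symm
  · rw [← toStableLinear_eq_zero_iff (k := k), ← Module.forall_dual_apply_eq_zero_iff k]
    exact (((e (S.toStable.obj X) (S.toStable.obj Y)).surjective.comp
      (toStableLinear_surjective (k := k) X Y)).forall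
      (p := fun φ => φ (toStableLinear k S Y _ h) = 0)).symm

namespace SerrePairing

variable (P : SerrePairing k hS)

theorem exists_right {X Y : C} [Module.Finite k (X ⟶ Y)] (φ : (X ⟶ Y) →ₗ[k] k)
    (hφ : ∀ f ∈ factorIdeal S.proj X Y, φ f = 0) : ∃ h, ∀ f, P.D X Y f h = φ f := by
  obtain ⟨h, hh⟩ := exists_eq_of_forall_apply_eq_zero (P.D X Y).flip φ
    fun f hf => hφ f ((P.left_eq_zero_iff f).1 hf)
  exact ⟨h, LinearMap.congr_fun hh⟩

theorem eq_zero_of_mem_left {X Y : C} {f : X ⟶ Y} (hf : f ∈ factorIdeal S.proj X Y)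
    (h : Y ⟶ hS.cosyzygy (hS.cosyzygy X)) : P.D X Y f h = 0 :=
  (P.left_eq_zero_iff f).2 hf h

theorem eq_zero_of_mem_right {X Y : C} (f : X ⟶ Y) {h : Y ⟶ hS.cosyzygy (hS.cosyzygy X)}
    (hh : h ∈ factorIdeal S.proj _ _) : P.D X Y f h = 0 :=
  (P.right_eq_zero_iff h).2 hh f

end SerrePairing

section Connecting

variable {C : Type u} [Category.{v} C] [Preadditive C] {S : ExactStructure C} {X K : C}

/-- `δ : X ⟶ ΣK` is a connecting morphism of the extension `e` of `X` by `K`: it represents the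
class of `e` in the stable category, where `Ext¹(X, K) = Hom(X, ΣK)`. -/
def Extension.IsConnecting (e : S.Extension X K) (H : S.InjHull K) (δ : X ⟶ H.Z) : Prop :=
  ∃ b : e.mid ⟶ H.I, e.i ≫ b = H.i ∧ e.p ≫ δ = b ≫ H.p

theorem Extension.exists_isConnecting (e : S.Extension X K) (H : S.InjHull K) :
    ∃ δ, e.IsConnecting H δ := by
  obtain ⟨b, hb⟩ := H.inj e.i e.inflation H.i
  obtain ⟨δ, hδ⟩ := e.exists_desc (b ≫ H.p) (by rw [reassoc_of% hb, H.zero])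
  exact ⟨δ, b, hb, hδ⟩

theorem InjHull.exists_extension_isConnecting (H : S.InjHull K) (δ : X ⟶ H.Z) :
    ∃ e : S.Extension X K, e.IsConnecting H δ := by
  obtain ⟨e, b, hb, pb⟩ := H.toExtension.exists_pullback δ
  exact ⟨e, b, hb, pb.w.symm⟩

variable {e : S.Extension X K} {H : S.InjHull K} {δ : X ⟶ H.Z}

theorem Extension.exists_sub_comp_mem (hS : S.IsFrobenius) (e : S.Extension X K) {Z : C}
    (H' : S.InjHull Z) {y : e.mid ⟶ H'.Z} (hy : e.i ≫ y ∈ factorIdeal S.proj K H'.Z) :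
    ∃ y' : X ⟶ H'.Z, y - e.p ≫ y' ∈ factorIdeal S.proj e.mid H'.Z := by
  obtain ⟨l, hl⟩ := exists_lift_of_mem_factorIdeal hy H'.p H'.toExtension.deflation
  obtain ⟨l', hl'⟩ := H'.inj e.i e.inflation l
  obtain ⟨y', hy'⟩ := e.exists_desc (y - l' ≫ H'.p) (by simp [reassoc_of% hl', hl])
  refine ⟨y', ?_⟩
  rw [hy', sub_sub_cancel]
  exact comp_mem_factorIdeal (H'.proj hS) _ _

namespace Extension.IsConnecting

theorem comp_mem (h : e.IsConnecting H δ) (hS : S.IsFrobenius) :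
    e.p ≫ δ ∈ factorIdeal S.proj e.mid H.Z := by
  obtain ⟨b, -, hb⟩ := h
  exact hb ▸ comp_mem_factorIdeal (H.proj hS) _ _

theorem exists_extend (h : e.IsConnecting H δ) {Z : C} {H' : S.InjHull Z} {g : K ⟶ Z}
    {g' : H.Z ⟶ H'.Z} (hg : H.Induces H' g g') (hδ : δ ≫ g' ∈ factorIdeal S.proj X H'.Z) :
    ∃ g₁ : e.mid ⟶ Z, e.i ≫ g₁ = g := by
  obtain ⟨b, hb, hbδ⟩ := h
  obtain ⟨m, hm, hmg⟩ := hg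
  obtain ⟨l, hl⟩ := exists_lift_of_mem_factorIdeal hδ H'.p H'.toExtension.deflation
  obtain ⟨g₁, hg₁⟩ := H'.toExtension.exists_lift (b ≫ m - e.p ≫ l)
    (by simp [hl, ← hmg, reassoc_of% hbδ])
  have := H'.toExtension.mono_i
  refine ⟨g₁, ?_⟩
  rw [← cancel_mono H'.i, Category.assoc, hg₁, Preadditive.comp_sub, reassoc_of% hb,
    reassoc_of% e.zero, zero_comp, sub_zero, hm]

theorem isSplitMono (h : e.IsConnecting H δ) (hδ : δ ∈ factorIdeal S.proj X H.Z) :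
    IsSplitMono e.i := by
  have hid : H.Induces H (𝟙 K) (𝟙 H.Z) := ⟨𝟙 _, by simp, by simp⟩
  obtain ⟨r, hr⟩ := h.exists_extend hid (by rwa [Category.comp_id])
  exact IsSplitMono.mk' ⟨r, hr⟩

theorem mem_of_retraction (h : e.IsConnecting H δ) (hS : S.IsFrobenius) {r : e.mid ⟶ K}
    (hr : e.i ≫ r = 𝟙 K) : δ ∈ factorIdeal S.proj X H.Z := by
  obtain ⟨b, hb, hbδ⟩ := h
  obtain ⟨m, hm⟩ := e.exists_desc (b - r ≫ H.i) (by simp [hb, reassoc_of% hr])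
  have hδ : δ = m ≫ H.p := by
    rw [← cancel_epi e.p, reassoc_of% hm, hbδ, Preadditive.sub_comp, Category.assoc, H.zero,
      comp_zero, sub_zero]
  exact hδ ▸ comp_mem_factorIdeal (H.proj hS) _ _

theorem exists_lift (h : e.IsConnecting H δ) {Z : C} {f : Z ⟶ X}
    (hf : f ≫ δ ∈ factorIdeal S.proj Z H.Z) : ∃ g : Z ⟶ e.mid, g ≫ e.p = f := by
  obtain ⟨b, hb, hbδ⟩ := h
  obtain ⟨e', f', hi, pb⟩ := e.exists_pullback f
  have h' : e'.IsConnecting H (f ≫ δ) :=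
    ⟨f' ≫ b, by rw [reassoc_of% hi, hb], by rw [← reassoc_of% pb.w, hbδ, Category.assoc]⟩
  have := h'.isSplitMono hf
  obtain ⟨g, hg⟩ := e'.exists_desc (f' - retraction e'.i ≫ e.i) (by simp [hi])
  exact ⟨g, by rw [← cancel_epi e'.p, reassoc_of% hg]; simp [e.zero, pb.w]⟩

theorem exists_sub_comp_mem [HasBinaryBiproducts C] (h : e.IsConnecting H δ) (hS : S.IsFrobenius)
    {Z : C} (hZ : S.Ext1Vanishes Z e.mid) (y : Z ⟶ H.Z) :
    ∃ f : Z ⟶ X, y - f ≫ δ ∈ factorIdeal S.proj Z H.Z := by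
  obtain ⟨b, hb, hbδ⟩ := h
  obtain ⟨e', b', hb', hy⟩ := H.exists_extension_isConnecting y
  obtain ⟨n, hn⟩ := hZ.exists_extend e' e.i
  obtain ⟨f, hf⟩ := e'.exists_desc (n ≫ e.p) (by rw [reassoc_of% hn, e.zero])
  obtain ⟨m, hm⟩ := e'.exists_desc (b' - n ≫ b) (by simp [hb', reassoc_of% hn, hb])
  have hyf : y - f ≫ δ = m ≫ H.p := by
    rw [← cancel_epi e'.p, reassoc_of% hm, Preadditive.comp_sub, reassoc_of% hf, hbδ,
      Preadditive.sub_comp, Category.assoc, hy]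
  exact ⟨f, hyf ▸ comp_mem_factorIdeal (H.proj hS) _ _⟩

end Extension.IsConnecting

variable [HasBinaryBiproducts C]

theorem InjHull.ext1Vanishes_iff (hS : S.IsFrobenius) (H : S.InjHull K) (X : C) :
    S.Ext1Vanishes X K ↔ ∀ δ : X ⟶ H.Z, δ ∈ factorIdeal S.proj X H.Z := by
  rw [ExactStructure.ext1Vanishes_iff]
  constructor
  · intro h δ
    obtain ⟨e, he⟩ := H.exists_extension_isConnecting δ
    have := h e
    exact he.mem_of_retraction hS (IsSplitMono.id e.i)
  · intro h e
    obtain ⟨δ, hδ⟩ := e.exists_isConnecting H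
    exact hδ.isSplitMono (h δ)

theorem SerrePairing.ext1Vanishes_symm {k : Type w} [Field k] [Linear k C] {hS : S.IsFrobenius}
    (P : SerrePairing k hS) {X Y : C} (h : S.Ext1Vanishes X Y) : S.Ext1Vanishes Y X := by
  rw [(hS.hull X).ext1Vanishes_iff hS]
  intro δ
  refine (P.left_eq_zero_iff δ).1 fun f => P.eq_zero_of_mem_right δ ?_
  obtain ⟨f', hf'⟩ := InjHull.exists_induces_of_hom hS (hS.hull X) (hS.hull (hS.hull Y).Z) f
  exact hf'.mem hS (((hS.hull Y).ext1Vanishes_iff hS X).1 h f')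

end Connecting

end ExactStructure

/-- `p : B ⟶ X` is a right almost split morphism in the full subcategory `T`: the radical morphisms
from objects of `T` to `X` are those factoring through `p`. -/
structure IsRightAlmostSplit {C : Type u} [Category.{v} C] [Preadditive C] (T : ObjectProperty C)
    {B X : C} (p : B ⟶ X) : Prop where
  mem : T B
  inRad : InRad p
  exists_lift : ∀ Z, T Z → ∀ h : Z ⟶ X, InRad h → ∃ g, g ≫ p = h

/-- `i : X ⟶ B` is a left almost split morphism in the full subcategory `T`: the radical morphisms
from `X` to objects of `T` are those factoring through `i`. -/
structure IsLeftAlmostSplit {C : Type u} [Category.{v} C] [Preadditive C] (T : ObjectProperty C)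
    {X B : C} (i : X ⟶ B) : Prop where
  mem : T B
  inRad : InRad i
  exists_extend : ∀ Z, T Z → ∀ g : X ⟶ Z, InRad g → ∃ h, i ≫ h = g

namespace ExactStructure

section AlmostSplit

variable {C : Type u} [Category.{v} C] [Preadditive C] {S : ExactStructure C}

theorem inRad_of_mem_factorIdeal (hS : S.IsFrobenius) {X : C} [IsLocalRing (End X)]
    (hX : ¬ S.proj X) {f : X ⟶ X} (hf : f ∈ factorIdeal S.proj X X) : InRad f := by
  rw [inRad_iff_not_isIso]
  intro hiso
  obtain ⟨Q, q, hQ, hq⟩ := hS.enough_proj X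
  obtain ⟨s, hs⟩ := exists_lift_of_mem_factorIdeal hf q hq
  refine hX fun A B p hp g => ?_
  obtain ⟨l, hl⟩ := hQ p hp (q ≫ inv f ≫ g)
  exact ⟨s ≫ l, by rw [Category.assoc, hl, reassoc_of% hs, IsIso.hom_inv_id_assoc]⟩

variable {k : Type w} [Field k] [Linear k C] {T : ObjectProperty C} {hS : S.IsFrobenius} {X : C}
  {r : (X ⟶ X) →ₗ[k] k}

theorem IsClusterTilting.exists_isRightAlmostSplit [HasBinaryBiproducts C] [IsLocalRing (End X)]
    (hT : S.IsClusterTilting T) (P : SerrePairing k hS) [Module.Finite k (X ⟶ X)]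
    (hX : ¬ S.proj X) (hr : IsResidueMap r) :
    ∃ (K : C) (e : S.Extension X K), IsRightAlmostSplit T e.p := by
  obtain ⟨η, hη⟩ := P.exists_right r fun f hf =>
    (hr.eq_zero_iff f).2 (inRad_of_mem_factorIdeal hS hX hf)
  obtain ⟨e₀, h₀⟩ := (hS.hull (hS.cosyzygy X)).exists_extension_isConnecting η
  have lift₀ {Z : C} {h : Z ⟶ X} (hh : InRad h) : ∃ g, g ≫ e₀.p = h := by
    refine h₀.exists_lift ((P.right_eq_zero_iff _).1 fun s => ?_)
    rw [← P.comp_right, hη, hr.eq_zero_iff]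
    exact hh.comp_left s
  have not_section (s : X ⟶ e₀.mid) : s ≫ e₀.p ≠ 𝟙 X := fun hs => by
    have hmem : η ∈ factorIdeal S.proj _ _ := by
      rw [← Category.id_comp η, ← hs, Category.assoc]
      exact factorIdeal_comp_left S.proj s (h₀.comp_mem hS)
    have hid := hη (𝟙 X)
    rw [P.eq_zero_of_mem_right _ hmem, hr.map_id] at hid
    exact zero_ne_one hid
  obtain ⟨_, e₁, -, hB, approx⟩ := hT.exists_approx hS e₀.mid
  obtain ⟨K, j, hj, hc⟩ := S.deflation_comp e₁.p e₀.p e₁.deflation e₀.deflation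
  refine ⟨K, ⟨_, j, e₁.p ≫ e₀.p, hj, hc⟩, hB, ?_, fun Z hZ h hh => ?_⟩
  · by_contra hp
    obtain ⟨g, hg⟩ := exists_section_of_not_inRad hp
    exact not_section (g ≫ e₁.p) (by rw [Category.assoc, hg])
  · obtain ⟨g, hg⟩ := lift₀ hh
    obtain ⟨g', hg'⟩ := approx Z hZ g
    exact ⟨g', by rw [reassoc_of% hg', hg]⟩

variable {K : C} {e : S.Extension X K} {δ : X ⟶ hS.cosyzygy K}
  {ε : hS.cosyzygy K ⟶ hS.cosyzygy (hS.cosyzygy X)}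

theorem Extension.IsConnecting.exists_dual (he : e.IsConnecting (hS.hull K) δ)
    (P : SerrePairing k hS) [Module.Finite k (X ⟶ X)] (hr : IsResidueMap r) (hp : InRad e.p) :
    ∃ ε, ∀ f, P.D X _ (f ≫ δ) ε = r f := by
  obtain ⟨ε, hε⟩ := exists_eq_of_forall_apply_eq_zero
    (P.D X (hS.cosyzygy K) ∘ₗ Linear.rightComp k X δ).flip r fun f hf => by
      obtain ⟨g, rfl⟩ := he.exists_lift ((P.left_eq_zero_iff (f ≫ δ)).1 hf)
      exact (hr.eq_zero_iff _).2 (hp.comp_left g)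
  exact ⟨ε, LinearMap.congr_fun hε⟩

theorem SerrePairing.apply_comp_cosyzygyMap (P : SerrePairing k hS)
    (hε : ∀ f, P.D X _ (f ≫ δ) ε = r f) {Z : C} (g : X ⟶ Z) (h : Z ⟶ X) :
    P.D Z _ (h ≫ δ) (ε ≫ hS.cosyzygyMap (hS.cosyzygyMap g)) = r (g ≫ h) := by
  rw [← P.comp_left, ← Category.assoc, hε]

variable [HasBinaryBiproducts C]

theorem Extension.IsConnecting.mem_of_forall_apply_eq_zero (he : e.IsConnecting (hS.hull K) δ)
    (P : SerrePairing k hS) {Z : C} (hZ : S.Ext1Vanishes Z e.mid)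
    {h : hS.cosyzygy K ⟶ hS.cosyzygy (hS.cosyzygy Z)}
    (hh : ∀ f : Z ⟶ X, P.D Z _ (f ≫ δ) h = 0) : h ∈ factorIdeal S.proj _ _ := by
  refine (P.right_eq_zero_iff h).1 fun y => ?_
  obtain ⟨f, hf⟩ := he.exists_sub_comp_mem hS hZ y
  simpa [hh] using P.eq_zero_of_mem_left hf h

variable {ε' : K ⟶ hS.cosyzygy X}

theorem Extension.IsConnecting.comp_cosyzygyMap_mem (he : e.IsConnecting (hS.hull K) δ)
    (P : SerrePairing k hS) (hr : IsResidueMap r) (hε : ∀ f, P.D X _ (f ≫ δ) ε = r f)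
    (hε' : (hS.hull K).Induces (hS.hull (hS.cosyzygy X)) ε' ε)
    {Z : C} (hZ : S.Ext1Vanishes Z e.mid) {g : X ⟶ Z} (hg : InRad g) :
    ε' ≫ hS.cosyzygyMap g ∈ factorIdeal S.proj _ _ := by
  refine (hε'.comp (hS.cosyzygyMap_induces _)).mem_of_mem hS
    (he.mem_of_forall_apply_eq_zero P hZ fun f => ?_)
  rw [P.apply_comp_cosyzygyMap hε, hr.eq_zero_iff]
  exact hg.comp_right f

theorem IsClusterTilting.exists_sub_comp_cosyzygyMap_mem [IsLocalRing (End X)]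
    (hT : S.IsClusterTilting T) (P : SerrePairing k hS) (hr : IsResidueMap r)
    (hp : IsRightAlmostSplit T e.p) (he : e.IsConnecting (hS.hull K) δ)
    (hε : ∀ f, P.D X _ (f ≫ δ) ε = r f)
    (hε' : (hS.hull K).Induces (hS.hull (hS.cosyzygy X)) ε' ε) {Z : C} (hZ : T Z)
    [Module.Finite k (Z ⟶ X)] (y : K ⟶ hS.cosyzygy Z) :
    ∃ g : X ⟶ Z, y - ε' ≫ hS.cosyzygyMap g ∈ factorIdeal S.proj _ _ := by
  obtain ⟨g, hg⟩ := hr.exists_eq_comp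
    ((P.D Z _).flip (hS.cosyzygyMap y) ∘ₗ Linear.rightComp k Z δ) fun h hh => by
      obtain ⟨g, rfl⟩ := hp.exists_lift Z hZ h hh
      refine P.eq_zero_of_mem_left (f := (g ≫ e.p) ≫ δ) ?_ _
      rw [Category.assoc]
      exact factorIdeal_comp_left S.proj g (he.comp_mem hS)
  refine ⟨g, ((hS.cosyzygyMap_induces y).sub (hε'.comp (hS.cosyzygyMap_induces _))).mem_of_mem hS
    (he.mem_of_forall_apply_eq_zero P (hT.rigid Z _ hZ hp.mem) fun f => ?_)⟩
  rw [map_sub, P.apply_comp_cosyzygyMap hε, ← hg]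
  exact sub_self _

theorem IsClusterTilting.mid_of_isConnecting (hT : S.IsClusterTilting T) (P : SerrePairing k hS)
    (hX : T X) {e₁ : S.Extension K X} (h₁ : e₁.IsConnecting (hS.hull X) ε')
    (h : ∀ Z, T Z → ∀ y : K ⟶ hS.cosyzygy Z,
      ∃ g : X ⟶ Z, y - ε' ≫ hS.cosyzygyMap g ∈ factorIdeal S.proj _ _) : T e₁.mid := by
  refine hT.maximal _ fun Z hZ => P.ext1Vanishes_symm ?_
  rw [(hS.hull Z).ext1Vanishes_iff hS]
  intro y
  obtain ⟨y', hy'⟩ := e₁.exists_sub_comp_mem hS (hS.hull Z)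
    (((hS.hull Z).ext1Vanishes_iff hS X).1 (hT.rigid X Z hX hZ) (e₁.i ≫ y))
  obtain ⟨g, hg⟩ := h Z hZ y'
  have hy : y = (y - e₁.p ≫ y') + (e₁.p ≫ (y' - ε' ≫ hS.cosyzygyMap g) +
      (e₁.p ≫ ε') ≫ hS.cosyzygyMap g) := by
    simp only [Preadditive.comp_sub, Category.assoc]
    abel
  rw [hy]
  exact add_mem hy' (add_mem (factorIdeal_comp_left _ _ hg)
    (factorIdeal_comp_right _ (h₁.comp_mem hS) _))

variable [IsLocalRing (End X)]

theorem IsClusterTilting.exists_isLeftAlmostSplit (hT : S.IsClusterTilting T)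
    (P : SerrePairing k hS) [∀ Z : C, Module.Finite k (Z ⟶ X)] (hX : T X) (hr : IsResidueMap r)
    (hp : IsRightAlmostSplit T e.p) : ∃ e₁ : S.Extension K X, IsLeftAlmostSplit T e₁.i := by
  obtain ⟨δ, he⟩ := e.exists_isConnecting (hS.hull K)
  obtain ⟨ε, hε⟩ := he.exists_dual P hr hp.inRad
  obtain ⟨ε', hε'⟩ := InjHull.exists_induces_of_hom hS _ _ ε
  obtain ⟨e₁, h₁⟩ := (hS.hull X).exists_extension_isConnecting ε'
  refine ⟨e₁, ?_, ?_, fun Z hZ g hg => ?_⟩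
  · exact hT.mid_of_isConnecting P hX h₁ fun Z hZ =>
      hT.exists_sub_comp_cosyzygyMap_mem P hr hp he hε hε' hZ
  · by_contra hi
    obtain ⟨d, hd⟩ := exists_retraction_of_not_inRad hi
    have hid := hε (𝟙 X)
    rw [P.eq_zero_of_mem_right _ (hε'.mem hS (h₁.mem_of_retraction hS hd)), hr.map_id] at hid
    exact zero_ne_one hid
  · exact h₁.exists_extend (hS.cosyzygyMap_induces g)
      (he.comp_cosyzygyMap_mem P hr hε hε' (hT.rigid Z _ hZ hp.mem) hg)

/-- The presentation of `T` by its quiver has no minimal relations from `X` to itself. -/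
theorem IsClusterTilting.exists_eq_comp_of_comp_eq_zero (hT : S.IsClusterTilting T) (hX : T X)
    (hloop : ∀ f : X ⟶ X, InRad f → RadSqThrough T f) {e₁ : S.Extension K X}
    (hi : IsLeftAlmostSplit T e₁.i) {a : X ⟶ e.mid} (ha : InRad a) (hap : a ≫ e.p = 0) :
    ∃ c : X ⟶ e₁.mid, InRad c ∧ a = c ≫ e₁.p ≫ e.i := by
  obtain ⟨b, hb⟩ := e.exists_lift a hap
  obtain ⟨c, hc⟩ := (hT.rigid X X hX hX).exists_lift e₁ b
  refine ⟨c, ?_, by rw [reassoc_of% hc, hb]⟩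
  by_contra hrad
  obtain ⟨d, hd⟩ := exists_retraction_of_not_inRad hrad
  obtain ⟨Z, g, h, hZ, hg, hh, hid⟩ := hloop _ (hi.inRad.comp_right d)
  obtain ⟨g', rfl⟩ := hi.exists_extend Z hZ g hg
  obtain ⟨m, hm⟩ := e₁.exists_desc (d - g' ≫ h) (by simp [hid])
  obtain ⟨n, hn⟩ := (hT.rigid X X hX hX).exists_extend e m
  have hone : 𝟙 X = (c ≫ g') ≫ h + a ≫ n := by
    rw [Category.assoc, ← hb, Category.assoc, hn, ← hc, Category.assoc, hm, Preadditive.comp_sub,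
      hd]
    simp
  have hradid : InRad (𝟙 X) := hone ▸ (hh.comp_left _).add (ha.comp_right n)
  exact hradid.not_isIso (id_ne_zero_of_isLocalRing X) inferInstance

end AlmostSplit

end ExactStructure

section ArrowPart

variable {k : Type w} [Field k] {C : Type u} [Category.{v} C] [Preadditive C] [Linear k C]
  {T : ObjectProperty C} {X Y Z : C} {r : (Y ⟶ Y) →ₗ[k] k} {α : (X ⟶ Y) →ₗ[k] k}

/-- Given a residue map `r` of `Y` and an arrow from `X` to `Y` with dual functional `α`, the
morphism `y` is a factor `Y ⟶ Z` left over when the arrow is split off from `u : X ⟶ Z`. Such a `y`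
is determined by `u` up to radical morphisms. -/
def IsArrowPart (r : (Y ⟶ Y) →ₗ[k] k) (α : (X ⟶ Y) →ₗ[k] k) (u : X ⟶ Z) (y : Y ⟶ Z) : Prop :=
  ∀ z : Z ⟶ Y, α (u ≫ z) = r (y ≫ z)

namespace IsArrowPart

theorem comp {u : X ⟶ Z} {y : Y ⟶ Z} (h : IsArrowPart r α u y) {W : C} (g : Z ⟶ W) :
    IsArrowPart r α (u ≫ g) (y ≫ g) := fun z => by
  simpa only [Category.assoc] using h (g ≫ z)

theorem add {u u' : X ⟶ Z} {y y' : Y ⟶ Z} (h : IsArrowPart r α u y) (h' : IsArrowPart r α u' y') :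
    IsArrowPart r α (u + u') (y + y') := fun z => by
  simp only [Preadditive.add_comp, map_add, h z, h' z]

theorem smul {u : X ⟶ Z} {y : Y ⟶ Z} (h : IsArrowPart r α u y) (c : k) :
    IsArrowPart r α (c • u) (c • y) := fun z => by
  simp only [Linear.smul_comp, map_smul, h z]

theorem sub_inRad [IsLocalRing (End Y)] (hr : IsResidueMap r) {u : X ⟶ Z} {y y' : Y ⟶ Z}
    (h : IsArrowPart r α u y) (h' : IsArrowPart r α u y') : InRad (y - y') := by
  by_contra hrad
  obtain ⟨z, hz⟩ := exists_retraction_of_not_inRad hrad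
  have hrz : r ((y - y') ≫ z) = 0 := by
    rw [Preadditive.sub_comp, map_sub, ← h z, ← h' z, sub_self]
  rw [hz, hr.map_id] at hrz
  exact one_ne_zero hrz

end IsArrowPart

/-- The radical morphisms from `X` to `Z` together with their arrow parts. -/
def radArrowSubmodule (r : (Y ⟶ Y) →ₗ[k] k) (α : (X ⟶ Y) →ₗ[k] k) (Z : C) :
    Submodule k ((X ⟶ Z) × (Y ⟶ Z)) where
  carrier := {a | InRad a.1 ∧ IsArrowPart r α a.1 a.2}
  add_mem' ha hb := ⟨ha.1.add hb.1, ha.2.add hb.2⟩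
  zero_mem' := ⟨inRad_zero X Z, fun z => by simp⟩
  smul_mem' c _ ha := ⟨ha.1.smul c, ha.2.smul c⟩

variable (hα : ∀ f, RadSqThrough T f → α f = 0)
include hα

theorem exists_isArrowPart [IsLocalRing (End Y)] (hr : IsResidueMap r) [Module.Finite k (Z ⟶ Y)]
    (hZ : T Z) {u : X ⟶ Z} (hu : InRad u) : ∃ y, IsArrowPart r α u y :=
  hr.exists_eq_comp (α ∘ₗ Linear.leftComp k Y u) fun h hh => hα _ ⟨Z, u, h, hZ, hu, hh, rfl⟩

theorem isArrowPart_zero (hZ : T Z) (hZY : ∀ z : Z ⟶ Y, InRad z) {u : X ⟶ Z} (hu : InRad u) :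
    IsArrowPart r α u 0 := fun z => by
  rw [hα _ ⟨Z, u, z, hZ, hu, hZY z, rfl⟩, zero_comp, map_zero]

theorem isArrowPart_smul_id [IsLocalRing (End Y)] (hr : IsResidueMap r) (hY : T Y) {u : X ⟶ Y}
    (hu : InRad u) : IsArrowPart r α u (α u • 𝟙 Y) := fun z => by
  have h := hα _ ⟨Y, u, _, hY, hu, hr.inRad_sub_smul_id z, rfl⟩
  rw [Preadditive.comp_sub, map_sub, sub_eq_zero, Linear.comp_smul, Category.comp_id,
    map_smul] at h
  rw [h, Linear.smul_comp, Category.id_comp, map_smul, smul_eq_mul, smul_eq_mul, mul_comm]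

end ArrowPart

namespace ExactStructure

section Functional

variable {k : Type w} [Field k] [IsAlgClosed k] {C : Type u} [Category.{v} C] [Preadditive C]
  [Linear k C] [HasBinaryBiproducts C] [∀ X Y : C, Module.Finite k (X ⟶ Y)]
  {S : ExactStructure C} {T : ObjectProperty C} {hS : S.IsFrobenius} {X Y : C}
  [IsLocalRing (End X)] [IsLocalRing (End Y)]

namespace IsClusterTilting

theorem exists_functional_eq_of_isArrowPart (hT : S.IsClusterTilting T) (P : SerrePairing k hS)
    (hX : T X) (hXp : ¬ S.proj X) (hloop : ∀ f : X ⟶ X, InRad f → RadSqThrough T f)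
    {r : (Y ⟶ Y) →ₗ[k] k} (hr : IsResidueMap r)
    {α : (X ⟶ Y) →ₗ[k] k} (hα : ∀ f, RadSqThrough T f → α f = 0)
    {β : (Y ⟶ X) →ₗ[k] k} (hβ : ∀ f, RadSqThrough T f → β f = 0) :
    ∃ ψ : (X ⟶ X) →ₗ[k] k, ∀ Z, T Z → ∀ (u : X ⟶ Z) (v : Z ⟶ X) (y : Y ⟶ Z),
      InRad u → InRad v → IsArrowPart r α u y → ψ (u ≫ v) = β (y ≫ v) := by
  obtain ⟨ρ, hρ⟩ := exists_isResidueMap k X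
  obtain ⟨K, e, hp⟩ := hT.exists_isRightAlmostSplit P hXp hρ
  obtain ⟨e₁, hi⟩ := hT.exists_isLeftAlmostSplit P hX hρ hp
  have hker (a : X ⟶ e.mid) (y : Y ⟶ e.mid) (ha : InRad a) (hy : IsArrowPart r α a y)
      (hap : a ≫ e.p = 0) : β (y ≫ e.p) = 0 := by
    obtain ⟨c, hc, rfl⟩ := hT.exists_eq_comp_of_comp_eq_zero hX hloop hi ha hap
    obtain ⟨y', hy'⟩ := exists_isArrowPart hα hr hi.mem hc
    have hβ' := hβ _ ⟨e.mid, _, e.p, hp.mem, hy.sub_inRad hr (hy'.comp _), hp.inRad, rfl⟩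
    simpa only [Preadditive.sub_comp, Category.assoc, e.zero, comp_zero, sub_zero] using hβ'
  obtain ⟨ψ, hψ⟩ := exists_functional_comp_eq
    (Linear.rightComp k X e.p ∘ₗ LinearMap.fst k _ _ ∘ₗ (radArrowSubmodule r α e.mid).subtype)
    (β ∘ₗ Linear.rightComp k Y e.p ∘ₗ LinearMap.snd k _ _ ∘ₗ
      (radArrowSubmodule r α e.mid).subtype)
    fun a ha => hker a.1.1 a.1.2 a.2.1 a.2.2 ha
  refine ⟨ψ, fun Z hZ u v y hu hv hy => ?_⟩
  obtain ⟨v, rfl⟩ := hp.exists_lift Z hZ v hv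
  simpa using hψ ⟨(u ≫ v, y ≫ v), hu.comp_right v, hy.comp v⟩

/-- The functional on closed paths through `X` that is dual to the path `X ⟶ Y ⟶ X` of two arrows
with dual functionals `α` and `β`. -/
theorem exists_functional_comp_eq_mul (hT : S.IsClusterTilting T) (P : SerrePairing k hS)
    (hX : T X) (hXp : ¬ S.proj X) (hY : T Y) (hXY : IsEmpty (X ≅ Y))
    (hloop : ∀ f : X ⟶ X, InRad f → RadSqThrough T f)
    {α : (X ⟶ Y) →ₗ[k] k} (hα : ∀ f, RadSqThrough T f → α f = 0)
    {β : (Y ⟶ X) →ₗ[k] k} (hβ : ∀ f, RadSqThrough T f → β f = 0) :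
    ∃ ψ : (X ⟶ X) →ₗ[k] k, (∀ u v, ψ (u ≫ v) = α u * β v) ∧
      ∀ Z, T Z → (∀ z : Z ⟶ Y, InRad z) → ∀ (u : X ⟶ Z) (v : Z ⟶ X), InRad u → InRad v →
        ψ (u ≫ v) = 0 := by
  obtain ⟨r, hr⟩ := exists_isResidueMap k Y
  obtain ⟨ψ, hψ⟩ := hT.exists_functional_eq_of_isArrowPart P hX hXp hloop hr hα hβ
  refine ⟨ψ, fun u v => ?_, fun Z hZ hZY u v hu hv => ?_⟩
  · have hu := inRad_of_isEmpty_iso hXY u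
    have hv := inRad_of_isEmpty_iso ⟨fun e => hXY.false e.symm⟩ v
    rw [hψ Y hY u v _ hu hv (isArrowPart_smul_id hα hr hY hu), Linear.smul_comp, Category.id_comp,
      map_smul, smul_eq_mul]
  · rw [hψ Z hZ u v 0 hu hv (isArrowPart_zero hα hZ hZY hu), zero_comp, map_zero]

end IsClusterTilting

end Functional

end ExactStructure

section KrullSchmidt

variable {C : Type u} [Category.{v} C] [Preadditive C]

theorem exists_addMonoidHom_eq_conj {V : Type w} [AddCommGroup V] {ι : Type*} (X : ι → C)
    (φ : ∀ i, (X i ⟶ X i) →+ V) (hcomm : ∀ i j f g, φ i (f ≫ g) = φ j (g ≫ f)) (Z : C) :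
    ∃ t : (Z ⟶ Z) →+ V, (∀ i (e : Z ≅ X i) f, t f = φ i (e.inv ≫ f ≫ e.hom)) ∧
      ((∀ i, IsEmpty (Z ≅ X i)) → ∀ f, t f = 0) := by
  by_cases h : ∃ i, Nonempty (Z ≅ X i)
  · obtain ⟨i, ⟨e⟩⟩ := h
    refine ⟨AddMonoidHom.mk' (fun f => φ i (e.inv ≫ f ≫ e.hom)) fun f g => ?_,
      fun j e' f => ?_, fun h => ((h i).false e).elim⟩
    · rw [Preadditive.add_comp, Preadditive.comp_add, map_add]
    · simpa using hcomm i j (e.inv ≫ e'.hom) (e'.inv ≫ f ≫ e.hom)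
  · exact ⟨0, fun i e => (h ⟨i, ⟨e⟩⟩).elim, fun _ _ => rfl⟩

variable [HasFiniteBiproducts C]

theorem biproduct_π_comp_ι_add_toSubtype_comp_fromSubtype {n : ℕ} (Y : Fin n → C) (l : Fin n) :
    biproduct.π Y l ≫ biproduct.ι Y l +
      biproduct.toSubtype Y (· ≠ l) ≫ biproduct.fromSubtype Y (· ≠ l) = 𝟙 (⨁ Y) := by
  classical
  rw [biproduct.toSubtype_fromSubtype]
  refine biproduct.hom_ext' _ _ fun j => ?_
  obtain rfl | hj := eq_or_ne j l
  · simp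
  · simp [hj, biproduct.ι_π_ne_assoc Y hj]

theorem IsKrullSchmidt.exists_retracts (hKS : IsKrullSchmidt C) (Z : C) :
    ∃ (n : ℕ) (Y : Fin n → C) (ρ : ∀ l, Retract (Y l) Z), (∀ l, IsLocalRing (End (Y l))) ∧
      ∑ l, (ρ l).r ≫ (ρ l).i = 𝟙 Z ∧
      ∀ l, ∃ (R : C) (σ : Retract R Z), (ρ l).r ≫ (ρ l).i + σ.r ≫ σ.i = 𝟙 Z := by
  obtain ⟨n, Y, hY, ⟨e⟩⟩ := hKS Z
  have transport (p : ⨁ Y ⟶ ⨁ Y) (hp : p = 𝟙 _) : e.hom ≫ p ≫ e.inv = 𝟙 Z := by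
    rw [hp, Category.id_comp, e.hom_inv_id]
  let ρ (l : Fin n) : Retract (Y l) Z :=
    { i := biproduct.ι Y l ≫ e.inv, r := e.hom ≫ biproduct.π Y l }
  let σ (l : Fin n) : Retract (⨁ Subtype.restrict (· ≠ l) Y) Z :=
    { i := biproduct.fromSubtype Y (· ≠ l) ≫ e.inv
      r := e.hom ≫ biproduct.toSubtype Y (· ≠ l) }
  refine ⟨n, Y, ρ, hY, ?_, fun l => ⟨_, σ l, ?_⟩⟩
  · simpa only [ρ, Preadditive.comp_sum, Preadditive.sum_comp, Category.assoc] using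
      transport _ biproduct.total
  · simpa only [ρ, σ, Preadditive.comp_add, Preadditive.add_comp, Category.assoc] using
      transport _ (biproduct_π_comp_ι_add_toSubtype_comp_fromSubtype Y l)

theorem TraceOn.exists_extend_of_isKrullSchmidt {V : Type w} [AddCommGroup V]
    (hKS : IsKrullSchmidt C) {T : ObjectProperty C} [T.IsStableUnderRetracts]
    (τ : TraceOn (fun Z => T Z ∧ IsLocalRing (End Z)) V) :
    ∃ τ' : TraceOn T V, ∀ {X : C} (hX : T X ∧ IsLocalRing (End X)) (f : X ⟶ X),
      τ'.val hX.1 f = τ.val hX f := by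
  obtain ⟨τ', h⟩ := τ.exists_extend_sumRetract (𝟭 C)
  have hsum (Z : C) (hZ : T Z) :
      Nonempty (SumRetract (𝟭 C) (fun Z => T Z ∧ IsLocalRing (End Z)) Z) := by
    obtain ⟨n, Y, ρ, hY, hρ, -⟩ := hKS.exists_retracts Z
    exact ⟨{ n := n, Y := Y, mem := fun l => ⟨T.prop_of_retract (ρ l) hZ, hY l⟩,
             ι := fun l => (ρ l).i, π := fun l => (ρ l).r, sum_eq_id := hρ }⟩
  exact ⟨τ'.restrict hsum, fun hX f => h hX (hsum _ hX.1) f⟩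

theorem exists_traceOn_of_family {V : Type w} [AddCommGroup V] (hKS : IsKrullSchmidt C)
    {T : ObjectProperty C} [T.IsStableUnderRetracts] {ι : Type*} (X : ι → C)
    (hX : ∀ i, T (X i) ∧ IsLocalRing (End (X i))) (φ : ∀ i, (X i ⟶ X i) →+ V)
    (hcomm : ∀ i j f g, φ i (f ≫ g) = φ j (g ≫ f))
    (hzero : ∀ i Z, T Z → IsLocalRing (End Z) → (∀ j, IsEmpty (Z ≅ X j)) →
      ∀ (f : X i ⟶ Z) (g : Z ⟶ X i), φ i (f ≫ g) = 0) :
    ∃ τ : TraceOn T V, ∀ i f, τ.val (hX i).1 f = φ i f := by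
  choose t ht ht₀ using exists_addMonoidHom_eq_conj X φ hcomm
  have hleft (i : ι) {Z Z' : C} (e : Z ≅ X i) (hZ' : T Z' ∧ IsLocalRing (End Z')) (f : Z ⟶ Z')
      (g : Z' ⟶ Z) : t Z (f ≫ g) = t Z' (g ≫ f) := by
    rw [ht Z i e]
    by_cases h : ∃ j, Nonempty (Z' ≅ X j)
    · obtain ⟨j, ⟨e'⟩⟩ := h
      rw [ht Z' j e']
      simpa using hcomm i j (e.inv ≫ f ≫ e'.hom) (e'.inv ≫ g ≫ e.hom)
    · simp only [not_exists, not_nonempty_iff] at h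
      rw [ht₀ Z' h]
      simpa using hzero i Z' hZ'.1 hZ'.2 h (e.inv ≫ f) (g ≫ e.hom)
  let τ : TraceOn (fun Z => T Z ∧ IsLocalRing (End Z)) V :=
    { val := fun {Z} _ => t Z
      comm := fun {Z Z'} hZ hZ' f g => by
        by_cases h : ∃ i, Nonempty (Z ≅ X i)
        · obtain ⟨i, ⟨e⟩⟩ := h
          exact hleft i e hZ' f g
        by_cases h' : ∃ i, Nonempty (Z' ≅ X i)
        · obtain ⟨i, ⟨e⟩⟩ := h'
          exact (hleft i e hZ g f).symm
        simp only [not_exists, not_nonempty_iff] at h h'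
        rw [ht₀ Z h, ht₀ Z' h'] }
  obtain ⟨τ', hτ'⟩ := τ.exists_extend_of_isKrullSchmidt hKS
  exact ⟨τ', fun i f => by simpa using (hτ' (hX i) f).trans (ht (X i) i (Iso.refl _) f)⟩

theorem exists_traceOn_of_pair {V : Type w} [AddCommGroup V] (hKS : IsKrullSchmidt C)
    {T : ObjectProperty C} [T.IsStableUnderRetracts] {X Y : C} [IsLocalRing (End X)]
    [IsLocalRing (End Y)] (hX : T X) (hY : T Y) (φ : (X ⟶ X) →+ V) (χ : (Y ⟶ Y) →+ V)
    (hφ : ∀ f g : X ⟶ X, φ (f ≫ g) = φ (g ≫ f)) (hχ : ∀ f g : Y ⟶ Y, χ (f ≫ g) = χ (g ≫ f))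
    (hφχ : ∀ (f : X ⟶ Y) (g : Y ⟶ X), φ (f ≫ g) = χ (g ≫ f))
    (hzero : ∀ Z, T Z → IsLocalRing (End Z) → IsEmpty (Z ≅ X) → IsEmpty (Z ≅ Y) →
      (∀ (f : X ⟶ Z) (g : Z ⟶ X), φ (f ≫ g) = 0) ∧ ∀ (f : Y ⟶ Z) (g : Z ⟶ Y), χ (f ≫ g) = 0) :
    ∃ τ : TraceOn T V, ∀ f, τ.val hX f = φ f := by
  let pair : Bool → C
    | true => X
    | false => Y
  let values : ∀ i, (pair i ⟶ pair i) →+ V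
    | true => φ
    | false => χ
  have hpair : ∀ i, T (pair i) ∧ IsLocalRing (End (pair i))
    | true => ⟨hX, ‹_›⟩
    | false => ⟨hY, ‹_›⟩
  have hcomm : ∀ i j f g, values i (f ≫ g) = values j (g ≫ f)
    | true, true, f, g => hφ f g
    | true, false, f, g => hφχ f g
    | false, true, f, g => (hφχ g f).symm
    | false, false, f, g => hχ f g
  obtain ⟨τ, hτ⟩ := exists_traceOn_of_family hKS pair hpair values hcomm fun i Z hZ hloc h =>
    match i with
    | true => (hzero Z hZ hloc (h true) (h false)).1
    | false => (hzero Z hZ hloc (h true) (h false)).2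
  exact ⟨τ, hτ true⟩

end KrullSchmidt

section LinearTraces

theorem isArtinianRing_end (k : Type w) [Field k] {C : Type u} [Category.{v} C] [Preadditive C]
    [Linear k C] (X : C) [h : Module.Finite k (X ⟶ X)] : IsArtinianRing (End X) :=
  have : Module.Finite k (End X) := h
  IsArtinianRing.of_finite k (End X)

variable {k : Type w} [Field k] [IsAlgClosed k] {C : Type u} [Category.{v} C] [Preadditive C]
  [Linear k C] {X Y : C}

theorem map_comp_comm [IsLocalRing (End X)] [Module.Finite k (X ⟶ X)] (ψ : (X ⟶ X) →ₗ[k] k)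
    (hψ : ∀ f g : X ⟶ X, InRad f → InRad g → ψ (f ≫ g) = 0) (f g : X ⟶ X) :
    ψ (f ≫ g) = ψ (g ≫ f) := by
  obtain ⟨a, ha⟩ := exists_inRad_sub_smul_id (k := k) f
  obtain ⟨b, hb⟩ := exists_inRad_sub_smul_id (k := k) g
  have hcomm : f ≫ g - g ≫ f =
      (f - a • 𝟙 X) ≫ (g - b • 𝟙 X) - (g - b • 𝟙 X) ≫ (f - a • 𝟙 X) := by
    simp only [Preadditive.sub_comp, Preadditive.comp_sub, Linear.smul_comp, Linear.comp_smul,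
      Category.id_comp, Category.comp_id, smul_smul, smul_sub, mul_comm]
    abel
  rw [← sub_eq_zero, ← map_sub, hcomm, map_sub, hψ _ _ ha hb, hψ _ _ hb ha, sub_zero]

namespace ExactStructure.IsClusterTilting

variable [HasFiniteBiproducts C] {S : ExactStructure C} {T : ObjectProperty C}

theorem radSqThrough_of_inRad (k : Type w) [Field k] [IsAlgClosed k] [Linear k C]
    [∀ X Y : C, Module.Finite k (X ⟶ Y)] [IsLocalRing (End X)] (hT : S.IsClusterTilting T)
    (hS : S.IsFrobenius) (hab : IsAbelian (ModCat C)) (hgl : hab.FiniteGlobalDimension)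
    (hKS : IsKrullSchmidt C) (hX : T X) {f : X ⟶ X} (hf : InRad f) : RadSqThrough T f := by
  have := hasBinaryBiproducts_of_finite_biproducts C
  have := hT.isStableUnderRetracts
  have := isArtinianRing_end k X
  by_contra hf'
  obtain ⟨ψ, hψf, hψ⟩ := exists_functional_of_not_radSqThrough (k := k)
    (fun _ _ h h' => hT.biprod h h') hX hf'
  obtain ⟨τ, hτ⟩ := exists_traceOn_of_family hKS (fun _ : Unit => X) (fun _ => ⟨hX, ‹_›⟩)
    (fun _ => ψ.toAddMonoidHom)
    (fun _ _ f g => map_comp_comm ψ (fun f g hf hg => hψ _ ⟨X, f, g, hX, hf, hg, rfl⟩) f g)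
    (fun _ Z hZ _ h f g => hψ _ ⟨Z, f, g, hZ,
      inRad_of_isEmpty_iso ⟨fun e => (h ()).false e.symm⟩ f, inRad_of_isEmpty_iso (h ()) g, rfl⟩)
  exact hψf ((hτ () f).symm.trans (hT.trace_eq_zero hS hab hgl τ hX hf.isNilpotent))

theorem radSqThrough_or_radSqThrough [∀ X Y : C, Module.Finite k (X ⟶ Y)]
    [IsLocalRing (End X)] [IsLocalRing (End Y)] (hT : S.IsClusterTilting T) {hS : S.IsFrobenius}
    (P : SerrePairing k hS) (hab : IsAbelian (ModCat C)) (hgl : hab.FiniteGlobalDimension)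
    (hKS : IsKrullSchmidt C) (hX : T X) (hXp : ¬ S.proj X) (hY : T Y) (hYp : ¬ S.proj Y)
    (hXY : IsEmpty (X ≅ Y)) (a : X ⟶ Y) (b : Y ⟶ X) : RadSqThrough T a ∨ RadSqThrough T b := by
  have := hasBinaryBiproducts_of_finite_biproducts C
  have := hT.isStableUnderRetracts
  have := isArtinianRing_end k X
  have hYX : IsEmpty (Y ≅ X) := ⟨fun e => hXY.false e.symm⟩
  have hbiprod (Y Z : C) (hY : T Y) (hZ : T Z) : T (Y ⊞ Z) := hT.biprod hY hZ
  have hloopX (f : X ⟶ X) (hf : InRad f) := hT.radSqThrough_of_inRad k hS hab hgl hKS hX hf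
  have hloopY (f : Y ⟶ Y) (hf : InRad f) := hT.radSqThrough_of_inRad k hS hab hgl hKS hY hf
  by_contra! hab'
  obtain ⟨α, hαa, hα⟩ := exists_functional_of_not_radSqThrough (k := k) hbiprod hX hab'.1
  obtain ⟨β, hβb, hβ⟩ := exists_functional_of_not_radSqThrough (k := k) hbiprod hY hab'.2
  obtain ⟨ψ, hψ, hψ₀⟩ := hT.exists_functional_comp_eq_mul P hX hXp hY hXY hloopX hα hβ
  obtain ⟨χ, hχ, hχ₀⟩ := hT.exists_functional_comp_eq_mul P hY hYp hX hYX hloopY hβ hα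
  obtain ⟨τ, hτ⟩ := exists_traceOn_of_pair hKS hX hY ψ.toAddMonoidHom χ.toAddMonoidHom
    (map_comp_comm ψ (hψ₀ X hX (inRad_of_isEmpty_iso hXY)))
    (map_comp_comm χ (hχ₀ Y hY (inRad_of_isEmpty_iso hYX)))
    (fun f g => (hψ f g).trans ((mul_comm _ _).trans (hχ g f).symm))
    fun Z hZ _ hZX hZY =>
      ⟨fun f g => hψ₀ Z hZ (inRad_of_isEmpty_iso hZY) f g
        (inRad_of_isEmpty_iso ⟨fun e => hZX.false e.symm⟩ f) (inRad_of_isEmpty_iso hZX g),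
      fun f g => hχ₀ Z hZ (inRad_of_isEmpty_iso hZX) f g
        (inRad_of_isEmpty_iso ⟨fun e => hZY.false e.symm⟩ f) (inRad_of_isEmpty_iso hZY g)⟩
  have hrad : InRad (a ≫ b) := (inRad_of_isEmpty_iso hXY a).comp_right b
  have htrace : ψ (a ≫ b) = 0 :=
    (hτ (a ≫ b)).symm.trans (hT.trace_eq_zero hS hab hgl τ hX hrad.isNilpotent)
  exact mul_ne_zero hαa hβb ((hψ a b).symm.trans htrace)

end ExactStructure.IsClusterTilting

end LinearTraces

section Indecomposable

variable {C : Type u} [Category.{v} C] [Preadditive C]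

theorem IsIndecomposable.of_iso {X Y : C} (hX : IsIndecomposable X)
    (e : X ≅ Y) : IsIndecomposable Y :=
  ⟨fun h => hX.1 (h.of_iso e), fun Z W b hb ⟨e'⟩ => hX.2 Z W b hb ⟨e ≪≫ e'⟩⟩

theorem IsIndecomposable.nonempty_iso {X Y R : C} (hX : IsIndecomposable X) (hY : ¬ IsZero Y)
    (ρ : Retract Y X) (σ : Retract R X) (h : ρ.r ≫ ρ.i + σ.r ≫ σ.i = 𝟙 X) :
    Nonempty (X ≅ Y) := by
  have hρσ : ρ.i ≫ σ.r = 0 := by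
    have : ρ.i ≫ σ.r ≫ σ.i = 0 := by simpa using ρ.i ≫= h
    simpa using this =≫ σ.r
  have hσρ : σ.i ≫ ρ.r = 0 := by
    have : σ.i ≫ ρ.r ≫ ρ.i = 0 := by simpa using σ.i ≫= h
    simpa using this =≫ ρ.r
  let b : BinaryBicone Y R :=
    { pt := X, fst := ρ.r, snd := σ.r, inl := ρ.i, inr := σ.i, inl_snd := hρσ, inr_fst := hσρ }
  have hR : IsZero R :=
    (hX.2 _ _ b ⟨isBinaryBilimitOfTotal b h⟩ ⟨Iso.refl X⟩).resolve_left hY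
  rw [hR.eq_of_src σ.i 0, comp_zero, add_zero] at h
  exact ⟨⟨ρ.r, ρ.i, h, ρ.retract⟩⟩

end Indecomposable

namespace ExactStructure

section SubQuotient

variable {C : Type u} [Category.{v} C] [Preadditive C] {S : ExactStructure C}
  {T : ObjectProperty C}

/-- The quotient functor from a full subcategory `T` to `T / P`. -/
abbrev toSubQuotient (S : ExactStructure C) (T : ObjectProperty C) :
    T.FullSubcategory ⥤ SubQuotient T S.proj :=
  CategoryTheory.Quotient.functor (idealRel (S.proj.inverseImage T.ι))

theorem isZero_toSubQuotient_obj {W : T.FullSubcategory} (hW : S.proj W.obj) :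
    IsZero ((S.toSubQuotient T).obj W) := by
  rw [IsZero.iff_id_eq_zero, ← CategoryTheory.Functor.map_id,
    ← (S.toSubQuotient T).map_zero W W]
  refine (CategoryTheory.Quotient.functor_map_eq_iff _ _ _).2 ?_
  change 𝟙 W - 0 ∈ _
  rw [sub_zero]
  exact AddSubgroup.subset_closure ⟨W, hW, 𝟙 W, 𝟙 W, by rw [Category.comp_id]⟩

theorem inRad_toSubQuotient_map {X Y : T.FullSubcategory} {f : X ⟶ Y} (hf : InRad f.hom) :
    InRad ((S.toSubQuotient T).map f) := by
  intro g
  obtain ⟨g, rfl⟩ := (S.toSubQuotient T).map_surjective g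
  have h : IsIso (𝟙 X - f ≫ g) := (T.isIso_hom_iff _).1 (hf g.hom)
  have := (S.toSubQuotient T).map_isIso (𝟙 X - f ≫ g)
  rwa [Functor.map_sub, CategoryTheory.Functor.map_id, Functor.map_comp] at this

theorem inRadSq_toSubQuotient_map {X Y : T.FullSubcategory} {f : X ⟶ Y}
    (hf : RadSqThrough T f.hom) : InRadSq ((S.toSubQuotient T).map f) := by
  obtain ⟨Z, g, h, hZ, hg, hh, hgh⟩ := hf
  let g' : X ⟶ ⟨Z, hZ⟩ := ObjectProperty.homMk g
  let h' : ⟨Z, hZ⟩ ⟶ Y := ObjectProperty.homMk h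
  have hf : f = g' ≫ h' := ObjectProperty.hom_ext _ hgh
  exact ⟨_, (S.toSubQuotient T).map g', (S.toSubQuotient T).map h',
    inRad_toSubQuotient_map hg, inRad_toSubQuotient_map hh, by rw [hf, Functor.map_comp]⟩

theorem exists_hom_of_hasIrreducible {X Y : SubQuotient T S.proj} (h : HasIrreducible X Y)
    {W W' : T.FullSubcategory} (e : X ≅ (S.toSubQuotient T).obj W)
    (e' : Y ≅ (S.toSubQuotient T).obj W') : ∃ f : W ⟶ W',
      InRad ((S.toSubQuotient T).map f) ∧ ¬ RadSqThrough T f.hom := by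
  obtain ⟨f, hf, hf'⟩ := h
  obtain ⟨g, hg⟩ := (S.toSubQuotient T).map_surjective (e.inv ≫ f ≫ e'.hom)
  refine ⟨g, ?_, fun h => hf' ?_⟩
  · rw [hg]
    exact (hf.comp_right _).comp_left _
  · obtain ⟨Z, a, b, ha, hb, hab⟩ := inRadSq_toSubQuotient_map (S := S) h
    rw [hg] at hab
    refine ⟨Z, e.hom ≫ a, b ≫ e'.inv, ha.comp_left _, hb.comp_right _, ?_⟩
    calc f = e.hom ≫ (e.inv ≫ f ≫ e'.hom) ≫ e'.inv := by simp
      _ = (e.hom ≫ a) ≫ b ≫ e'.inv := by rw [hab]; simp only [Category.assoc]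

theorem exists_iso_of_isIndecomposable [HasFiniteBiproducts C] [T.IsStableUnderRetracts]
    (hKS : IsKrullSchmidt C) {X : SubQuotient T S.proj} (hX : IsIndecomposable X) :
    ∃ W : T.FullSubcategory, IsLocalRing (End W.obj) ∧
      Nonempty (X ≅ (S.toSubQuotient T).obj W) := by
  let q := S.toSubQuotient T
  obtain ⟨n, Y, ρ, hY, hsum, hcompl⟩ := hKS.exists_retracts X.as.obj
  let lift {Z : C} (ρ : Retract Z X.as.obj) :
      Retract (⟨Z, T.prop_of_retract ρ X.as.property⟩ : T.FullSubcategory) X.as :=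
    { i := ObjectProperty.homMk ρ.i, r := ObjectProperty.homMk ρ.r
      retract := ObjectProperty.hom_ext _ ρ.retract }
  have hsum' : ∑ l, (lift (ρ l)).r ≫ (lift (ρ l)).i = 𝟙 X.as :=
    T.ι.map_injective ((Functor.map_sum T.ι _ _).trans hsum)
  obtain ⟨l, hl⟩ : ∃ l, ¬ IsZero (q.obj ⟨Y l, T.prop_of_retract (ρ l) X.as.property⟩) := by
    by_contra! h
    refine hX.1 ((IsZero.iff_id_eq_zero (q.obj X.as)).2 ?_)
    rw [← CategoryTheory.Functor.map_id, ← hsum', Functor.map_sum]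
    refine Finset.sum_eq_zero fun l _ => ?_
    rw [Functor.map_comp, (h l).eq_of_src (q.map (lift (ρ l)).i) 0, comp_zero]
  obtain ⟨R, σ, hσ⟩ := hcompl l
  have hσ' : (lift (ρ l)).r ≫ (lift (ρ l)).i + (lift σ).r ≫ (lift σ).i = 𝟙 X.as :=
    ObjectProperty.hom_ext _ hσ
  have hqσ := congrArg q.map hσ'
  simp only [Functor.map_add, Functor.map_comp, CategoryTheory.Functor.map_id] at hqσ
  exact ⟨_, hY l, IsIndecomposable.nonempty_iso hX hl ((lift (ρ l)).map q) ((lift σ).map q) hqσ⟩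

end SubQuotient

namespace IsClusterTilting

variable {C : Type u} [Category.{v} C] [Preadditive C] [HasFiniteBiproducts C]
  {S : ExactStructure C} {T : ObjectProperty C}

theorem exists_iso_of_quiverVertex (hT : S.IsClusterTilting T) (hKS : IsKrullSchmidt C)
    (x : QuiverVertex (SubQuotient T S.proj)) :
    ∃ W : T.FullSubcategory, IsLocalRing (End W.obj) ∧
      IsIndecomposable ((S.toSubQuotient T).obj W) ∧
      ∀ X, _root_.Quotient.mk (isIsomorphicSetoid _) X = x.1 →
        Nonempty (X ≅ (S.toSubQuotient T).obj W) := by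
  have := hasBinaryBiproducts_of_finite_biproducts C
  have := hT.isStableUnderRetracts
  obtain ⟨_, X, hX, rfl⟩ := x
  obtain ⟨W, hW, ⟨e⟩⟩ := exists_iso_of_isIndecomposable hKS hX
  refine ⟨W, hW, hX.of_iso e, fun Y hY => ?_⟩
  obtain ⟨e'⟩ := _root_.Quotient.exact hY
  exact ⟨e' ≪≫ e⟩

theorem not_hasIrreducible_self (k : Type w) [Field k] [IsAlgClosed k] [Linear k C]
    [∀ X Y : C, Module.Finite k (X ⟶ Y)] (hT : S.IsClusterTilting T) (hS : S.IsFrobenius)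
    (hab : IsAbelian (ModCat C)) (hgl : hab.FiniteGlobalDimension) (hKS : IsKrullSchmidt C)
    {W : T.FullSubcategory} [IsLocalRing (End W.obj)]
    (hW : IsIndecomposable ((S.toSubQuotient T).obj W)) {X Y : SubQuotient T S.proj}
    (e : X ≅ (S.toSubQuotient T).obj W) (e' : Y ≅ (S.toSubQuotient T).obj W) :
    ¬ HasIrreducible X Y := by
  intro h
  obtain ⟨f, hf, hf'⟩ := exists_hom_of_hasIrreducible h e e'
  refine hf' (hT.radSqThrough_of_inRad k hS hab hgl hKS W.property ?_)
  refine (inRad_iff_not_isIso f.hom).2 fun hiso => ?_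
  have : IsIso f := (T.isIso_hom_iff f).1 hiso
  exact hf.not_isIso (fun h => hW.1 ((IsZero.iff_id_eq_zero _).2 h))
    ((S.toSubQuotient T).map_isIso f)

theorem noLoops (k : Type w) [Field k] [IsAlgClosed k] [Linear k C]
    [∀ X Y : C, Module.Finite k (X ⟶ Y)] (hT : S.IsClusterTilting T) (hS : S.IsFrobenius)
    (hab : IsAbelian (ModCat C)) (hgl : hab.FiniteGlobalDimension) (hKS : IsKrullSchmidt C) :
    NoLoops (QuiverVertex (SubQuotient T S.proj)) := by
  refine fun x => ⟨fun ⟨X, Y, hX, hY, h⟩ => ?_⟩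
  obtain ⟨W, hloc, hW, iso⟩ := hT.exists_iso_of_quiverVertex hKS x
  exact hT.not_hasIrreducible_self k hS hab hgl hKS hW (iso X hX).some (iso Y hY).some h

variable {k : Type w} [Field k] [IsAlgClosed k] [Linear k C]
  [∀ X Y : C, Module.Finite k (X ⟶ Y)]

theorem not_hasIrreducible_and_hasIrreducible (hT : S.IsClusterTilting T) {hS : S.IsFrobenius}
    (P : SerrePairing k hS) (hab : IsAbelian (ModCat C)) (hgl : hab.FiniteGlobalDimension)
    (hKS : IsKrullSchmidt C) {W W' : T.FullSubcategory} [IsLocalRing (End W.obj)]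
    [IsLocalRing (End W'.obj)] (hW : IsIndecomposable ((S.toSubQuotient T).obj W))
    (hW' : IsIndecomposable ((S.toSubQuotient T).obj W')) {X Y X' Y' : SubQuotient T S.proj}
    (eX : X ≅ (S.toSubQuotient T).obj W) (eY : Y ≅ (S.toSubQuotient T).obj W')
    (eX' : X' ≅ (S.toSubQuotient T).obj W) (eY' : Y' ≅ (S.toSubQuotient T).obj W') :
    ¬ (HasIrreducible X Y ∧ HasIrreducible Y' X') := by
  rintro ⟨h, h'⟩
  by_cases hWW' : Nonempty (W.obj ≅ W'.obj)
  · exact hT.not_hasIrreducible_self k hS hab hgl hKS hW eX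
      (eY ≪≫ (S.toSubQuotient T).mapIso (T.isoMk hWW'.some).symm) h
  · have hproj {V : T.FullSubcategory} (hV : IsIndecomposable ((S.toSubQuotient T).obj V)) :
        ¬ S.proj V.obj := fun hp => hV.1 (isZero_toSubQuotient_obj hp)
    obtain ⟨a, -, ha⟩ := exists_hom_of_hasIrreducible h eX eY
    obtain ⟨b, -, hb⟩ := exists_hom_of_hasIrreducible h' eY' eX'
    exact (hT.radSqThrough_or_radSqThrough P hab hgl hKS W.property (hproj hW) W'.property
      (hproj hW') (not_nonempty_iff.1 hWW') a.hom b.hom).elim ha hb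

theorem noTwoCycles (hT : S.IsClusterTilting T) {hS : S.IsFrobenius} (P : SerrePairing k hS)
    (hab : IsAbelian (ModCat C)) (hgl : hab.FiniteGlobalDimension) (hKS : IsKrullSchmidt C) :
    NoTwoCycles (QuiverVertex (SubQuotient T S.proj)) := by
  refine fun x y => ⟨fun ⟨⟨X, Y, hX, hY, h⟩, ⟨Y', X', hY', hX', h'⟩⟩ => ?_⟩
  obtain ⟨W, hWloc, hW, isoW⟩ := hT.exists_iso_of_quiverVertex hKS x
  obtain ⟨W', hWloc', hW', isoW'⟩ := hT.exists_iso_of_quiverVertex hKS y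
  exact hT.not_hasIrreducible_and_hasIrreducible P hab hgl hKS hW hW' (isoW X hX).some
    (isoW' Y hY).some (isoW X' hX').some (isoW' Y' hY').some ⟨h, h'⟩

end IsClusterTilting

end ExactStructure

end FrobeniusCT

theorem theorem6p22 {k : Type w} [Field k] [IsAlgClosed k]
    {E : Type u} [Category.{v} E] [Preadditive E] [Linear k E] [HasFiniteBiproducts E]
    (hKS : FrobeniusCT.IsKrullSchmidt E)
    (hfin : ∀ X Y : E, Module.Finite k (X ⟶ Y))
    (hab : FrobeniusCT.IsAbelian (FrobeniusCT.ModCat E))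
    (hgl : hab.FiniteGlobalDimension)
    (S : FrobeniusCT.ExactStructure E) (hS : S.IsFrobenius)
    (hCY : FrobeniusCT.ExactStructure.IsTwoCalabiYau k hS)
    (T : ObjectProperty E) (hT : S.IsClusterTilting T) :
    FrobeniusCT.NoLoops (FrobeniusCT.QuiverVertex (FrobeniusCT.SubQuotient T S.proj)) ∧
    FrobeniusCT.NoTwoCycles (FrobeniusCT.QuiverVertex (FrobeniusCT.SubQuotient T S.proj)) := by
  obtain ⟨P⟩ := hCY.nonempty_serrePairing
  exact ⟨hT.noLoops k hS hab hgl hKS, hT.noTwoCycles P hab hgl hKS⟩
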